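/- Let $W$ be a standard Wiener process (with continuous paths) relative to a filtration on a probability space, let $I\subseteq\mathbb R$ be an open interval, and let $a_x,b_x:I\to\mathbb R$ be such that $a_x$ is continuous, $b_x$ is continuously differentiable and $b_x$ has no zero in $I$. Consider the Itô dynamic $$dx=a_x(x)\,dt+b_x(x)\,dW \qquad (*)$$ in $I$. A solution is an adapted process with continuous paths in $I$ on a random time interval $[0,\tau)$, where $\tau\in[0,\infty]$ is a stopping time, that satisfies $(*)$ there. (1) Let $u$ be twice continuously differentiable on $I$, let $a_u,b_u\in\mathbb R$, and let $x$ be a solution of $(*)$ on $[0,\tau)$. Then $u(x(t))$ is a Brownian motion with constant drift $a_u$ and volatility $b_u$ driven by $W$, i.e. $du=a_u\,dt+b_u\,dW$ on $[0,\tau)$, if and only if almost surely the two equations $$a_u=a_x u'+\tfrac12 b_x^2u'',\qquad b_u=b_xu'$$ hold at $x(t)$ for all $t<\tau$. Now say that $u$ maps the dynamic to a Brownian motion with drift $a_u$ and volatility $b_u$ if $(*)$ has, for every $y\in I$, a solution with $x(0)=y$ and $\tau>0$ almost surely, and if for every solution $x$ of $(*)$ one has $du(x(t))=a_u\,dt+b_u\,dW$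 on $[0,\tau)$. Let $a_u,b_u$ be real constants with $b_u\neq0$. (2) A twice continuously differentiable $u$ on $I$ maps the dynamic to a Brownian motion with drift $a_u$ and volatility $b_u$ if and only if, for all $x\in I$, $$u'(x)=\frac{b_u}{b_x(x)}\qquad\text{and}\qquad a_x(x)=\frac{a_u}{b_u}\,b_x(x)+\frac12\,b_x(x)\,b_x'(x).$$ (3) There is a strictly monotone (increasing or decreasing), twice continuously differentiable $u$ on $I$ that maps the dynamic to a Brownian motion with drift $a_u$ and volatility $b_u$ if and only if the consistency condition $a_x=\frac{a_u}{b_u}b_x+\frac12b_xb_x'$ holds on $I$. (4) If the consistency condition holds and $x_0\in I$, then the twice continuously differentiable functions $u$ on $I$ that map the dynamic to a Brownian motion with drift $a_u$ and volatility $b_u$ are exactly the functions $$u(x)=\int_{x_0}^x\frac{b_u}{b_x(\tilde x)}\,d\tilde x+C,\qquad C\in\mathbb R.$$ (5) There are constants $a_u$, $b_u\ne0$ and a strictly increasing, twice continuously differentiable $u$ on $I$ that maps the dynamic to a Brownian motion with drift $a_u$ and volatility $b_u$ if and only if there is a constant $k$ with $a_x=k\,b_x+\frac12b_xb_x'$ on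 $I$. -/

import Mathlib

open MeasureTheory ProbabilityTheory Filter Topology
open scoped NNReal ENNReal

/-- `W` is a standard Wiener process relative to the filtration `ℱ` (with continuous paths):
a Brownian motion adapted to `ℱ` whose increments after time `s` are independent of `ℱ s`. -/
structure IsWienerProcess {Ω : Type*} {mΩ : MeasurableSpace Ω} (P : Measure Ω)
    (ℱ : Filtration ℝ≥0 mΩ) (W : ℝ≥0 → Ω → ℝ) : Prop where
  isBrownian : IsBrownianReal W P
  continuous : ∀ ω, Continuous fun t => W t ω
  adapted : StronglyAdapted ℱ W
  indep : ∀ s t : ℝ≥0, s ≤ t →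
    Indep (MeasurableSpace.comap (fun ω => W t ω - W s ω) inferInstance) (ℱ s) P

/-- `0 = s n 0 ≤ s n 1 ≤ ⋯ ≤ s n (N n) = t` is, for each `n`, a partition of `[0, t]`, and the mesh
of these partitions tends to zero as `n → ∞`. -/
structure IsPartitionSeq (t : ℝ≥0) (N : ℕ → ℕ) (s : ℕ → ℕ → ℝ≥0) : Prop where
  mono : ∀ n, Monotone (s n)
  start : ∀ n, s n 0 = 0
  finish : ∀ n, s n (N n) = t
  mesh : ∀ δ : ℝ≥0, 0 < δ → ∀ᶠ n in atTop, ∀ i < N n, s n (i + 1) ≤ s n i + δ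

/-- `Y` is, at time `t` and on the event `{t < τ}`, the Itô integral `∫₀ᵗ H dW` of the process `H`
(adapted and with continuous paths on `[0, τ)`): the limit in probability on that event of the
left-endpoint Riemann sums, along every sequence of partitions of `[0, t]` with vanishing mesh. -/
def IsItoIntegralAt {Ω : Type*} {mΩ : MeasurableSpace Ω} (P : Measure Ω) (W H : ℝ≥0 → Ω → ℝ)
    (τ : Ω → WithTop ℝ≥0) (t : ℝ≥0) (Y : Ω → ℝ) : Prop :=
  ∀ (N : ℕ → ℕ) (s : ℕ → ℕ → ℝ≥0), IsPartitionSeq t N s →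
    TendstoInMeasure (P.restrict {ω | (t : WithTop ℝ≥0) < τ ω})
      (fun n ω => ∑ i ∈ Finset.range (N n),
        H (s n i) ω * (W (s n (i + 1)) ω - W (s n i) ω)) atTop Y

/-- `x` is a solution with values in `I`, up to the stopping time `τ`, of the Itô equation
`dx = a(x) dt + b(x) dW` (`a`, `b` continuous on `I`): on `[0, τ)` it is adapted, continuous,
`I`-valued, and `x(t) - x(0) = ∫₀ᵗ a(x(r)) dr + ∫₀ᵗ b(x(r)) dW(r)`.  The values of `x` from time `τ`
on play no role; `τ = ⊤` is a solution for all times. -/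
structure IsItoSolution {Ω : Type*} {mΩ : MeasurableSpace Ω} (P : Measure Ω)
    (ℱ : Filtration ℝ≥0 mΩ) (W : ℝ≥0 → Ω → ℝ) (I : Set ℝ) (a b : ℝ → ℝ)
    (x : ℝ≥0 → Ω → ℝ) (τ : Ω → WithTop ℝ≥0) : Prop where
  isStoppingTime : IsStoppingTime ℱ τ
  adapted : ∀ t : ℝ≥0,
    StronglyMeasurable[ℱ t] ({ω | (t : WithTop ℝ≥0) < τ ω}.indicator (x t))
  continuousOn : ∀ ω, ContinuousOn (fun t => x t ω) {t : ℝ≥0 | (t : WithTop ℝ≥0) < τ ω}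
  mem : ∀ (ω : Ω) (t : ℝ≥0), (t : WithTop ℝ≥0) < τ ω → x t ω ∈ I
  sde : ∀ t : ℝ≥0, IsItoIntegralAt P W (fun r ω => b (x r ω)) τ t
    (fun ω => x t ω - x 0 ω - ∫ r in (0 : ℝ)..(t : ℝ), a (x r.toNNReal ω))

/-- Up to the stopping time `τ`, the process `U` is a Brownian motion with constant drift `aᵤ` and
constant volatility `bᵤ` driven by `W`, that is, `dU = aᵤ dt + bᵤ dW`. -/
def IsBrownianWithDrift {Ω : Type*} {mΩ : MeasurableSpace Ω} (P : Measure Ω)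
    (ℱ : Filtration ℝ≥0 mΩ) (W : ℝ≥0 → Ω → ℝ) (aᵤ bᵤ : ℝ)
    (U : ℝ≥0 → Ω → ℝ) (τ : Ω → WithTop ℝ≥0) : Prop :=
  IsItoSolution P ℱ W Set.univ (fun _ => aᵤ) (fun _ => bᵤ) U τ

/-- The utility `u` turns the dynamic `dx = a(x) dt + b(x) dW` on `I` into a Brownian motion with
drift `aᵤ` and volatility `bᵤ`: the dynamic can be started at every wealth in `I`, and along every
solution `x` of it the utility `u(x(t))` is such a Brownian motion for the lifetime of `x`. -/
def MapsToBrownian {Ω : Type*} {mΩ : MeasurableSpace Ω} (P : Measure Ω)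
    (ℱ : Filtration ℝ≥0 mΩ) (W : ℝ≥0 → Ω → ℝ) (I : Set ℝ) (a b u : ℝ → ℝ) (aᵤ bᵤ : ℝ) : Prop :=
  (∀ y ∈ I, ∃ (x : ℝ≥0 → Ω → ℝ) (τ : Ω → WithTop ℝ≥0),
    IsItoSolution P ℱ W I a b x τ ∧ ∀ᵐ ω ∂P, 0 < τ ω ∧ x 0 ω = y) ∧
  ∀ (x : ℝ≥0 → Ω → ℝ) (τ : Ω → WithTop ℝ≥0), IsItoSolution P ℱ W I a b x τ →
    IsBrownianWithDrift P ℱ W aᵤ bᵤ (fun t ω => u (x t ω)) τ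

/-!
Itô's formula is proved from the Riemann sums. On `{t < τ}` the errors of the Euler steps for
`dX = A dt + B dW` over a partition are, in the limit of refined partitions, sums of increments of
`W` with small adapted coefficients. Such increments are centred and independent of the past, so
once the coefficients are truncated an `L²` bound shows that the sum of the squared errors, and any
sum of the errors weighted by an adapted process, vanish in probability as the mesh does. Taylor
expansion then applies path by path along almost surely converging subsequences.

Drift and volatility of a differential are unique, because a constant process has quadratic
variation zero. Hence `u(x)` is the Brownian motion exactly when the two equations hold along `x`,
and for `u' = bᵤ / b` the drift equation is the consistency condition. Conversely `u⁻¹`, applied to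
a Brownian motion with drift up to its exit from `u(I)`, solves the dynamic.
-/

section ConvergenceInMeasure

variable {Ω : Type*} {mΩ : MeasurableSpace Ω} {μ : Measure Ω}

theorem tendstoInMeasure_const {ι E : Type*} [PseudoEMetricSpace E] {l : Filter ι} (f : Ω → E) :
    TendstoInMeasure μ (fun _ => f) l f := fun ε hε => by
  simp only [edist_self, not_le.2 hε, Set.ofPred_false, measure_empty, tendsto_const_nhds]

theorem tendstoInMeasure_mono_measure {ι E : Type*} [EDist E] {ν : Measure Ω} (h : μ ≤ ν)
    {l : Filter ι} {f : ι → Ω → E} {g : Ω → E} (hf : TendstoInMeasure ν f l g) :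
    TendstoInMeasure μ f l g := fun ε hε =>
  tendsto_of_tendsto_of_tendsto_of_le_of_le tendsto_const_nhds (hf ε hε)
    (fun _ => zero_le) (fun _ => h _)

theorem tendstoInMeasure_pi {ι κ E : Type*} [Fintype κ] [PseudoEMetricSpace E]
    {l : Filter ι} {X : κ → ι → Ω → E} {Y : κ → Ω → E}
    (h : ∀ k, TendstoInMeasure μ (X k) l (Y k)) :
    TendstoInMeasure μ (fun n ω k => X k n ω) l (fun ω k => Y k ω) := by
  intro ε hε
  have hsum : Tendsto (fun n => ∑ k, μ {ω | ε ≤ edist (X k n ω) (Y k ω)}) l (𝓝 0) := by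
    rw [← Finset.sum_const_zero (s := Finset.univ (α := κ))]
    exact tendsto_finsetSum _ fun k _ => h k ε hε
  refine tendsto_of_tendsto_of_tendsto_of_le_of_le tendsto_const_nhds hsum (fun _ => zero_le) ?_
  intro n
  refine (measure_mono fun ω hω => ?_).trans (measure_biUnion_finset_le Finset.univ _)
  obtain ⟨k, hk, hle⟩ := (Finset.le_sup_iff (bot_lt_iff_ne_bot.2 hε.ne')).1 hω
  exact Set.mem_biUnion hk hle

theorem tendstoInMeasure_prodMk {ι E F : Type*} [PseudoEMetricSpace E] [PseudoEMetricSpace F]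
    {l : Filter ι} {X : ι → Ω → E} {X' : Ω → E} {Y : ι → Ω → F} {Y' : Ω → F}
    (hX : TendstoInMeasure μ X l X') (hY : TendstoInMeasure μ Y l Y') :
    TendstoInMeasure μ (fun n ω => (X n ω, Y n ω)) l (fun ω => (X' ω, Y' ω)) := by
  intro ε hε
  have hsum := (hX ε hε).add (hY ε hε)
  rw [add_zero] at hsum
  refine tendsto_of_tendsto_of_tendsto_of_le_of_le tendsto_const_nhds hsum (fun _ => zero_le)
    fun n => ?_
  refine (measure_mono fun ω hω => ?_).trans
    (measure_union_le {ω | ε ≤ edist (X n ω) (X' ω)} {ω | ε ≤ edist (Y n ω) (Y' ω)})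
  simpa only [Set.mem_ofPred_eq, Set.mem_union, Prod.edist_eq, le_max_iff] using hω

theorem tendstoInMeasure_sub {ι E : Type*} [SeminormedAddCommGroup E] {l : Filter ι}
    {X Y : ι → Ω → E} {X' Y' : Ω → E} (hX : TendstoInMeasure μ X l X')
    (hY : TendstoInMeasure μ Y l Y') :
    TendstoInMeasure μ (fun n ω => X n ω - Y n ω) l (fun ω => X' ω - Y' ω) := by
  rw [tendstoInMeasure_iff_norm] at *
  intro ε hε
  have hsum := (hX (ε / 2) (half_pos hε)).add (hY (ε / 2) (half_pos hε))
  rw [add_zero] at hsum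
  refine tendsto_of_tendsto_of_tendsto_of_le_of_le tendsto_const_nhds hsum (fun _ => zero_le)
    fun n => (measure_mono fun ω hω => ?_).trans (measure_union_le _ _)
  simp only [Set.mem_ofPred_eq, Set.mem_union] at hω ⊢
  by_contra! hlt
  have htri := norm_sub_le (X n ω - X' ω) (Y n ω - Y' ω)
  rw [← sub_sub_sub_comm] at htri
  linarith [hlt.1, hlt.2]

/-- The subsequence principle: pathwise reasoning along the subsequences on which a given sequence
converges yields convergence in measure. -/
theorem tendstoInMeasure_of_forall_subseq [IsFiniteMeasure μ] {E F : Type*}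
    [PseudoEMetricSpace E] [PseudoEMetricSpace F]
    {X : ℕ → Ω → E} {Y : Ω → E} (hX : TendstoInMeasure μ X atTop Y)
    {f : ℕ → Ω → F} {g : Ω → F} (hf : ∀ n, AEStronglyMeasurable (f n) μ)
    (hfg : ∀ᵐ ω ∂μ, ∀ ns : ℕ → ℕ, StrictMono ns →
      Tendsto (fun i => X (ns i) ω) atTop (𝓝 (Y ω)) →
      Tendsto (fun i => f (ns i) ω) atTop (𝓝 (g ω))) :
    TendstoInMeasure μ f atTop g := by
  rw [exists_seq_tendstoInMeasure_atTop_iff hf]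
  intro ns hns
  obtain ⟨ns', hns', hXae⟩ := (hX.comp hns.tendsto_atTop).exists_seq_tendsto_ae
  refine ⟨ns', hns', ?_⟩
  filter_upwards [hfg, hXae] with ω hω hXω
  exact hω (ns ∘ ns') (hns.comp hns') hXω

theorem tendstoInMeasure_zero_of_diagonal {E : Type*} [SeminormedAddCommGroup E]
    {F : ℕ → ℕ → Ω → E} {G : ℕ → Ω → E} (hFG : ∀ n, TendstoInMeasure μ (F n) atTop (G n))
    (hF : ∀ k : ℕ → ℕ, TendstoInMeasure μ (fun n => F n (k n)) atTop (fun _ => 0)) :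
    TendstoInMeasure μ G atTop (fun _ => 0) := by
  have hinv : Tendsto (fun n : ℕ => ((n : ℝ≥0∞) + 1)⁻¹) atTop (𝓝 0) := by
    simpa [Function.comp_def] using
      ENNReal.tendsto_inv_nat_nhds_zero.comp (tendsto_add_atTop_nat 1)
  have hclose : ∀ n : ℕ, ∃ k, μ {ω | 1 / ((n : ℝ) + 1) ≤ ‖F n k ω - G n ω‖}
      ≤ ((n : ℝ≥0∞) + 1)⁻¹ := fun n =>
    ((tendstoInMeasure_iff_norm.1 (hFG n) (1 / ((n : ℝ) + 1)) (by positivity)).eventually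
      (ge_mem_nhds (by simp))).exists
  choose k hk using hclose
  rw [tendstoInMeasure_iff_norm]
  intro ε hε
  have hlim := (tendstoInMeasure_iff_norm.1 (hF k) (ε / 2) (half_pos hε)).add hinv
  rw [add_zero] at hlim
  refine tendsto_of_tendsto_of_tendsto_of_le_of_le' tendsto_const_nhds hlim
    (Eventually.of_forall fun _ => zero_le) ?_
  filter_upwards [tendsto_one_div_add_atTop_nhds_zero_nat.eventually
    (gt_mem_nhds (half_pos hε))] with n hn
  refine ((measure_mono fun ω hω => ?_).trans (measure_union_le _ _)).trans
    (add_le_add le_rfl (hk n))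
  simp only [Set.mem_ofPred_eq, Set.mem_union, sub_zero] at hω ⊢
  by_contra! hlt
  have htri := norm_sub_le (F n (k n) ω) (F n (k n) ω - G n ω)
  rw [sub_sub_cancel] at htri
  linarith [hlt.1, hlt.2]

theorem tendstoInMeasure_zero_of_approx_integral_norm_le [IsFiniteMeasure μ] {E : Type*}
    [NormedAddCommGroup E] {S : ℕ → Ω → E} (hS : ∀ n, AEStronglyMeasurable (S n) μ)
    (h : ∀ δ > 0, ∃ S' : ℕ → Ω → E, (∀ n, Integrable (S' n) μ) ∧ (∀ n, ∫ ω, ‖S' n ω‖ ∂μ ≤ δ) ∧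
      ∀ᵐ ω ∂μ, Tendsto (fun n => S n ω - S' n ω) atTop (𝓝 0)) :
    TendstoInMeasure μ S atTop (fun _ => 0) := by
  rw [tendstoInMeasure_iff_measureReal_norm]
  intro ε hε
  rw [Metric.tendsto_atTop']
  intro η hη
  obtain ⟨S', hint, hle, hlim⟩ := h (ε / 2 * (η / 2)) (by positivity)
  have hdiff := tendstoInMeasure_iff_measureReal_norm.1 (tendstoInMeasure_of_tendsto_ae
    (fun n => (hS n).sub (hint n).1) hlim) (ε / 2) (half_pos hε)
  obtain ⟨n₀, hn₀⟩ := Metric.tendsto_atTop'.1 hdiff (η / 2) (half_pos hη)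
  refine ⟨n₀, fun n hn => ?_⟩
  have hsmall := hn₀ n hn
  simp only [Real.dist_eq, sub_zero, abs_of_nonneg measureReal_nonneg] at hsmall ⊢
  have hmarkov : μ.real {ω | ε / 2 ≤ ‖S' n ω‖} ≤ η / 2 :=
    le_of_mul_le_mul_left ((mul_meas_ge_le_integral_of_nonneg
      (ae_of_all _ fun ω => norm_nonneg (S' n ω)) (hint n).norm _).trans (hle n)) (half_pos hε)
  have hsub : {ω | ε ≤ ‖S n ω‖} ⊆ {ω | ε / 2 ≤ ‖S n ω - S' n ω‖} ∪ {ω | ε / 2 ≤ ‖S' n ω‖} := by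
    intro ω hω
    simp only [Set.mem_ofPred_eq, Set.mem_union] at hω ⊢
    by_contra! hlt
    have htri := norm_add_le (S n ω - S' n ω) (S' n ω)
    rw [sub_add_cancel] at htri
    linarith [hlt.1, hlt.2]
  calc μ.real {ω | ε ≤ ‖S n ω‖}
      ≤ μ.real {ω | ε / 2 ≤ ‖S n ω - S' n ω‖} + μ.real {ω | ε / 2 ≤ ‖S' n ω‖} :=
        (measureReal_mono hsub).trans (measureReal_union_le _ _)
    _ < η := by simp only [Pi.sub_apply] at hsmall; linarith

end ConvergenceInMeasure

section Innovations

variable {Ω : Type*} {mΩ : MeasurableSpace Ω} {P : Measure Ω}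

/-- `D` is a sequence of innovations for the discrete filtration `𝒢`: `D j` is revealed at time
`j + 1`, is independent of the past `𝒢 j`, is centred and has a second moment. -/
structure IsInnovationSeq (P : Measure Ω) (𝒢 : Filtration ℕ mΩ) (D : ℕ → Ω → ℝ) : Prop where
  measurable : ∀ j, Measurable[𝒢 (j + 1)] (D j)
  memLp : ∀ j, MemLp (D j) 2 P
  indep : ∀ j, Indep (MeasurableSpace.comap (D j) inferInstance) (𝒢 j) P
  integral_eq_zero : ∀ j, ∫ ω, D j ω ∂P = 0

namespace IsInnovationSeq

variable {𝒢 : Filtration ℕ mΩ} {D ξ : ℕ → Ω → ℝ} {K : ℝ}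

theorem integral_mul_eq_zero (hD : IsInnovationSeq P 𝒢 D) {j : ℕ} {η : Ω → ℝ}
    (hη : Measurable[𝒢 j] η) : ∫ ω, η ω * D j ω ∂P = 0 := by
  have hindep : IndepFun η (D j) P :=
    (IndepFun_iff_Indep _ _ _).2 (indep_of_indep_of_le_left (hD.indep j).symm hη.comap_le)
  rw [hindep.integral_fun_mul_eq_mul_integral (hη.mono (𝒢.le j) le_rfl).aestronglyMeasurable
    (hD.memLp j).aestronglyMeasurable, hD.integral_eq_zero, mul_zero]

theorem memLp_mul (hD : IsInnovationSeq P 𝒢 D) {j : ℕ} {η : Ω → ℝ}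
    (hη : Measurable[𝒢 j] η) (hK : ∀ ω, |η ω| ≤ K) : MemLp (fun ω => η ω * D j ω) 2 P :=
  (hD.memLp j).of_le_mul
    ((hη.mono (𝒢.le j) le_rfl).aestronglyMeasurable.mul (hD.memLp j).aestronglyMeasurable)
    (ae_of_all _ fun ω => (norm_mul _ _).trans_le
      (mul_le_mul_of_nonneg_right (hK ω) (norm_nonneg _)))

theorem const_mul (hD : IsInnovationSeq P 𝒢 D) (c : ℝ) :
    IsInnovationSeq P 𝒢 (fun j ω => c * D j ω) where
  measurable j := (hD.measurable j).const_mul c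
  memLp j := (hD.memLp j).const_mul c
  indep j := indep_of_indep_of_le_left (hD.indep j)
    ((comap_measurable (D j)).const_mul c).comap_le
  integral_eq_zero j := by rw [integral_const_mul, hD.integral_eq_zero, mul_zero]

theorem memLp_sum_mul (hD : IsInnovationSeq P 𝒢 D) (hξ : ∀ j, Measurable[𝒢 j] (ξ j))
    (hK : ∀ j ω, |ξ j ω| ≤ K) (s : Finset ℕ) :
    MemLp (fun ω => ∑ j ∈ s, ξ j ω * D j ω) 2 P :=
  memLp_finsetSum s fun j _ => hD.memLp_mul (hξ j) (hK j)

theorem measurable_sum_mul (hD : IsInnovationSeq P 𝒢 D) (hξ : ∀ j, Measurable[𝒢 j] (ξ j))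
    {s : Finset ℕ} {k : ℕ} (hs : ∀ j ∈ s, j < k) :
    Measurable[𝒢 k] (fun ω => ∑ j ∈ s, ξ j ω * D j ω) :=
  Finset.measurable_sum _ fun j hj =>
    ((hξ j).mono (𝒢.mono (hs j hj).le) le_rfl).mul
      ((hD.measurable j).mono (𝒢.mono (hs j hj)) le_rfl)

theorem integral_sq_sum_mul_le (hD : IsInnovationSeq P 𝒢 D) (hξ : ∀ j, Measurable[𝒢 j] (ξ j))
    (hK : ∀ j ω, |ξ j ω| ≤ K) (s : Finset ℕ) :
    ∫ ω, (∑ j ∈ s, ξ j ω * D j ω) ^ 2 ∂P ≤ K ^ 2 * ∑ j ∈ s, ∫ ω, D j ω ^ 2 ∂P := by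
  induction s using Finset.induction_on_max with
  | empty => simp
  | insert k s hs ih =>
    have hk : k ∉ s := fun h => lt_irrefl k (hs k h)
    set S : Ω → ℝ := fun ω => ∑ j ∈ s, ξ j ω * D j ω
    have hS : MemLp S 2 P := hD.memLp_sum_mul hξ hK s
    have hlast : MemLp (fun ω => ξ k ω * D k ω) 2 P := hD.memLp_mul (hξ k) (hK k)
    have hcross_int : Integrable (fun ω => S ω * ξ k ω * D k ω) P := by
      simpa only [Pi.mul_def, mul_assoc] using hS.integrable_mul hlast
    have hcross : ∫ ω, S ω * ξ k ω * D k ω ∂P = 0 :=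
      hD.integral_mul_eq_zero ((hD.measurable_sum_mul hξ hs).mul (hξ k))
    have hlast_le : ∫ ω, (ξ k ω * D k ω) ^ 2 ∂P ≤ K ^ 2 * ∫ ω, D k ω ^ 2 ∂P := by
      rw [← integral_const_mul]
      refine integral_mono hlast.integrable_sq ((hD.memLp k).integrable_sq.const_mul _) fun ω => ?_
      simp only [mul_pow]
      exact mul_le_mul_of_nonneg_right
        (sq_le_sq' (abs_le.1 (hK k ω)).1 (abs_le.1 (hK k ω)).2) (sq_nonneg _)
    calc ∫ ω, (∑ j ∈ insert k s, ξ j ω * D j ω) ^ 2 ∂P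
        = ∫ ω, ((ξ k ω * D k ω) ^ 2 + S ω ^ 2 + 2 * (S ω * ξ k ω * D k ω)) ∂P := by
          refine integral_congr_ae (ae_of_all _ fun ω => ?_)
          simp only [Finset.sum_insert hk, S]
          ring
      _ = ∫ ω, (ξ k ω * D k ω) ^ 2 ∂P + ∫ ω, S ω ^ 2 ∂P := by
          rw [integral_add (hlast.integrable_sq.fun_add hS.integrable_sq) (hcross_int.const_mul 2),
            integral_add hlast.integrable_sq hS.integrable_sq, integral_const_mul, hcross,
            mul_zero, add_zero]
      _ ≤ K ^ 2 * ∑ j ∈ insert k s, ∫ ω, D j ω ^ 2 ∂P := by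
          rw [Finset.sum_insert hk, mul_add]
          exact add_le_add hlast_le ih

theorem integral_sum_sq_sum_mul_le (hD : IsInnovationSeq P 𝒢 D) (hξ : ∀ j, Measurable[𝒢 j] (ξ j))
    (hK : ∀ j ω, |ξ j ω| ≤ K) {κ : Type*} (I : Finset κ) (J : κ → Finset ℕ) :
    ∫ ω, ∑ i ∈ I, (∑ j ∈ J i, ξ j ω * D j ω) ^ 2 ∂P
      ≤ K ^ 2 * ∑ i ∈ I, ∑ j ∈ J i, ∫ ω, D j ω ^ 2 ∂P := by
  rw [integral_finsetSum _ fun i _ => (hD.memLp_sum_mul hξ hK (J i)).integrable_sq, Finset.mul_sum]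
  exact Finset.sum_le_sum fun i _ => hD.integral_sq_sum_mul_le hξ hK (J i)

end IsInnovationSeq

/-- The value `z` if it is at most `K` in modulus, and zero otherwise; used to bound the
coefficients of a sum of innovations without changing the sums in which they are small already. -/
noncomputable def truncateAt (K z : ℝ) : ℝ := if |z| ≤ K then z else 0

theorem measurable_truncateAt (K : ℝ) : Measurable (truncateAt K) :=
  Measurable.ite (measurableSet_le measurable_id.abs measurable_const) measurable_id
    measurable_const

theorem abs_truncateAt_le {K : ℝ} (hK : 0 ≤ K) (z : ℝ) : |truncateAt K z| ≤ K := by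
  unfold truncateAt
  split_ifs with hz
  · exact hz
  · rwa [abs_zero]

theorem truncateAt_of_abs_le {K z : ℝ} (hz : |z| ≤ K) : truncateAt K z = z := if_pos hz

section Arrays

variable {𝒢 : ℕ → Filtration ℕ mΩ} {D ξ : ℕ → ℕ → Ω → ℝ} {C : ℝ} {T : Set Ω}

theorem tendstoInMeasure_sum_sq_sum_mul [IsFiniteMeasure P]
    (hD : ∀ n, IsInnovationSeq P (𝒢 n) (D n)) (hξ : ∀ n j, Measurable[𝒢 n j] (ξ n j))
    {N : ℕ → ℕ} {J : ℕ → ℕ → Finset ℕ}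
    (hvar : ∀ n, ∑ i ∈ Finset.range (N n), ∑ j ∈ J n i, ∫ ω, D n j ω ^ 2 ∂P ≤ C)
    (hT : MeasurableSet T)
    (hmax : ∀ ω ∈ T, ∀ δ > 0, ∀ᶠ n in atTop, ∀ i < N n, ∀ j ∈ J n i, |ξ n j ω| ≤ δ) :
    TendstoInMeasure (P.restrict T) (fun n ω => ∑ i ∈ Finset.range (N n),
      (∑ j ∈ J n i, ξ n j ω * D n j ω) ^ 2) atTop (fun _ => 0) := by
  refine tendstoInMeasure_zero_of_approx_integral_norm_le (fun n => ?_) fun δ hδ => ?_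
  · refine (Finset.measurable_sum _ fun i _ => Measurable.pow_const (Finset.measurable_sum _
      fun j _ => ?_) 2).aestronglyMeasurable
    exact ((hξ n j).mono ((𝒢 n).le j) le_rfl).mul
      (((hD n).measurable j).mono ((𝒢 n).le (j + 1)) le_rfl)
  set K : ℝ := √(δ / (|C| + 1))
  have hK_pos : 0 < K := Real.sqrt_pos.2 (by positivity)
  have hξK_meas : ∀ n j, Measurable[𝒢 n j] (fun ω => truncateAt K (ξ n j ω)) := fun n j =>
    (measurable_truncateAt K).comp (hξ n j)
  have hξK_le : ∀ n j ω, |truncateAt K (ξ n j ω)| ≤ K := fun n j ω =>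
    abs_truncateAt_le hK_pos.le _
  have hint := fun n => integrable_finsetSum (Finset.range (N n)) fun i _ =>
    ((hD n).memLp_sum_mul (hξK_meas n) (hξK_le n) (J n i)).integrable_sq
  refine ⟨fun n ω => ∑ i ∈ Finset.range (N n),
    (∑ j ∈ J n i, truncateAt K (ξ n j ω) * D n j ω) ^ 2, fun n => (hint n).restrict,
    fun n => ?_, (ae_restrict_iff' hT).2 (ae_of_all _ fun ω hω => ?_)⟩
  · simp_rw [Real.norm_of_nonneg (Finset.sum_nonneg fun _ _ => sq_nonneg _)]
    calc ∫ ω in T, ∑ i ∈ Finset.range (N n), (∑ j ∈ J n i, truncateAt K (ξ n j ω) * D n j ω) ^ 2 ∂P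
        ≤ ∫ ω, ∑ i ∈ Finset.range (N n), (∑ j ∈ J n i, truncateAt K (ξ n j ω) * D n j ω) ^ 2 ∂P :=
          setIntegral_le_integral (hint n)
            (ae_of_all _ fun ω => Finset.sum_nonneg fun i _ => sq_nonneg _)
      _ ≤ K ^ 2 * ∑ i ∈ Finset.range (N n), ∑ j ∈ J n i, ∫ ω, D n j ω ^ 2 ∂P :=
          (hD n).integral_sum_sq_sum_mul_le (hξK_meas n) (hξK_le n) _ (J n)
      _ ≤ δ / (|C| + 1) * (|C| + 1) := by
          rw [Real.sq_sqrt (by positivity)]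
          gcongr
          exact (hvar n).trans ((le_abs_self C).trans (lt_add_one _).le)
      _ = δ := div_mul_cancel₀ _ (by positivity)
  · refine tendsto_const_nhds.congr' ?_
    filter_upwards [hmax ω hω K hK_pos] with n hn
    refine (sub_eq_zero.2 (Finset.sum_congr rfl fun i hi => ?_)).symm
    congr 1
    exact Finset.sum_congr rfl fun j hj => by
      rw [truncateAt_of_abs_le (hn i (Finset.mem_range.1 hi) j hj)]

theorem tendstoInMeasure_sum_mul_innovation [IsFiniteMeasure P]
    (hD : ∀ n, IsInnovationSeq P (𝒢 n) (D n)) (hξ : ∀ n j, Measurable[𝒢 n j] (ξ n j))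
    {N : ℕ → ℕ} (hvar : ∀ n, ∑ j ∈ Finset.range (N n), ∫ ω, D n j ω ^ 2 ∂P ≤ C)
    (hT : MeasurableSet T)
    (hmax : ∀ ω ∈ T, ∀ δ > 0, ∀ᶠ n in atTop, ∀ j < N n, |ξ n j ω| ≤ δ) :
    TendstoInMeasure (P.restrict T) (fun n ω => ∑ j ∈ Finset.range (N n), ξ n j ω * D n j ω) atTop
      (fun _ => 0) := by
  have hsq := tendstoInMeasure_sum_sq_sum_mul hD hξ (N := fun _ => 1)
    (J := fun n _ => Finset.range (N n)) (by simpa using hvar) hT (by simpa using hmax)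
  rw [tendstoInMeasure_iff_norm] at hsq ⊢
  refine fun ε hε => (hsq (ε ^ 2) (by positivity)).congr fun n => ?_
  congr 1 with ω
  simp only [Finset.sum_range_one, sub_zero, norm_pow, Set.mem_ofPred_eq]
  exact pow_le_pow_iff_left₀ hε.le (norm_nonneg _) two_ne_zero

end Arrays

/-- The filtration `ℱ` observed at the times `r 0 ≤ r 1 ≤ ⋯` only. -/
def sampledFiltration {ι : Type*} [Preorder ι] (ℱ : Filtration ι mΩ) {r : ℕ → ι}
    (hr : Monotone r) : Filtration ℕ mΩ where
  seq j := ℱ (r j)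
  mono' _ _ hij := ℱ.mono (hr hij)
  le' j := ℱ.le (r j)

end Innovations

namespace IsWienerProcess

variable {Ω : Type*} {mΩ : MeasurableSpace Ω} {P : Measure Ω} {ℱ : Filtration ℝ≥0 mΩ}
  {W : ℝ≥0 → Ω → ℝ} {s t : ℝ≥0}

theorem isProbabilityMeasure (hW : IsWienerProcess P ℱ W) : IsProbabilityMeasure P :=
  hW.isBrownian.isGaussianProcess.isProbabilityMeasure

theorem measurable (hW : IsWienerProcess P ℱ W) (t : ℝ≥0) : Measurable[ℱ t] (W t) :=
  (hW.adapted t).measurable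

theorem measurable_increment (hW : IsWienerProcess P ℱ W) (hst : s ≤ t) :
    Measurable[ℱ t] (fun ω => W t ω - W s ω) :=
  (hW.measurable t).sub ((hW.measurable s).mono (ℱ.mono hst) le_rfl)

theorem hasLaw_increment (hW : IsWienerProcess P ℱ W) (hst : s ≤ t) :
    HasLaw (fun ω => W t ω - W s ω) (gaussianReal 0 (t - s)) P := by
  have hdist : nndist t.1 s.1 = t - s := by
    rw [← NNReal.coe_inj, coe_nndist, Real.dist_eq, NNReal.coe_sub hst,
      ← abs_of_nonneg (sub_nonneg.2 (NNReal.coe_le_coe.2 hst))]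
    rfl
  exact hdist ▸ hW.isBrownian.hasLaw_sub t s

theorem memLp_increment (hW : IsWienerProcess P ℱ W) (hst : s ≤ t) (p : ℝ≥0) :
    MemLp (fun ω => W t ω - W s ω) p P := by
  have hlaw := hW.hasLaw_increment hst
  have hid : MemLp id p (P.map fun ω => W t ω - W s ω) :=
    hlaw.map_eq ▸ memLp_id_gaussianReal p
  exact (memLp_map_measure_iff hid.aestronglyMeasurable hlaw.aemeasurable).1 hid

theorem integral_increment (hW : IsWienerProcess P ℱ W) (hst : s ≤ t) :
    ∫ ω, (W t ω - W s ω) ∂P = 0 := by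
  rw [(hW.hasLaw_increment hst).integral_eq, integral_id_gaussianReal]

theorem integral_sq_increment (hW : IsWienerProcess P ℱ W) (hst : s ≤ t) :
    ∫ ω, (W t ω - W s ω) ^ 2 ∂P = (t : ℝ) - s := by
  have hvar := (hW.hasLaw_increment hst).variance_eq
  rw [variance_id_gaussianReal, variance_eq_integral (hW.hasLaw_increment hst).aemeasurable,
    hW.integral_increment hst, NNReal.coe_sub hst] at hvar
  simpa only [sub_zero] using hvar

theorem memLp_sq_increment (hW : IsWienerProcess P ℱ W) (hst : s ≤ t) :
    MemLp (fun ω => (W t ω - W s ω) ^ 2 - ((t : ℝ) - s)) 2 P := by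
  have := hW.isProbabilityMeasure
  have hfour : ((4 : ℝ≥0) : ℝ≥0∞) / 2 = 2 := by
    rw [show ((4 : ℝ≥0) : ℝ≥0∞) = 2 * 2 by norm_num]
    exact ENNReal.mul_div_cancel_right (by simp) (by simp)
  have hsq := (hW.memLp_increment hst 4).norm_rpow_div 2
  rw [hfour] at hsq
  refine (hsq.congr_norm ?_ (ae_of_all _ fun ω => by simp)).sub (memLp_const _)
  exact (((hW.measurable_increment hst).pow_const 2).mono (ℱ.le t) le_rfl).aestronglyMeasurable

theorem integral_sq_increment_sub (hW : IsWienerProcess P ℱ W) (hst : s ≤ t) :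
    ∫ ω, ((W t ω - W s ω) ^ 2 - ((t : ℝ) - s)) ∂P = 0 := by
  have := hW.isProbabilityMeasure
  rw [integral_sub (hW.memLp_increment hst 2).integrable_sq (integrable_const _),
    hW.integral_sq_increment hst, integral_const, probReal_univ, one_smul, sub_self]

theorem integral_sq_sq_increment_sub (hW : IsWienerProcess P ℱ W) (hst : s ≤ t) :
    ∫ ω, ((W t ω - W s ω) ^ 2 - ((t : ℝ) - s)) ^ 2 ∂P
      = ((t : ℝ) - s) ^ 2 * ∫ z, (z ^ 2 - 1) ^ 2 ∂(gaussianReal 0 1) := by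
  have hlaw := hW.hasLaw_increment hst
  rw [← NNReal.coe_sub hst]
  generalize t - s = v at hlaw
  have hscale : gaussianReal 0 v = (gaussianReal 0 1).map (fun z => √(v : ℝ) * z) := by
    rw [gaussianReal_map_const_mul, mul_zero]
    congr 1
    ext
    simp
  calc ∫ ω, ((W t ω - W s ω) ^ 2 - (v : ℝ)) ^ 2 ∂P
      = ∫ z, (z ^ 2 - (v : ℝ)) ^ 2 ∂(gaussianReal 0 v) :=
        hlaw.integral_comp (f := fun z : ℝ => (z ^ 2 - (v : ℝ)) ^ 2) (by fun_prop)
    _ = ∫ z, ((√(v : ℝ) * z) ^ 2 - (v : ℝ)) ^ 2 ∂(gaussianReal 0 1) := by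
        rw [hscale, integral_map (by fun_prop) (by fun_prop)]
    _ = (v : ℝ) ^ 2 * ∫ z, (z ^ 2 - 1) ^ 2 ∂(gaussianReal 0 1) := by
        rw [← integral_const_mul]
        congr 1 with z
        rw [mul_pow, Real.sq_sqrt v.coe_nonneg]
        ring

variable {r : ℕ → ℝ≥0}

theorem isInnovationSeq_increment (hW : IsWienerProcess P ℱ W) (hr : Monotone r) :
    IsInnovationSeq P (sampledFiltration ℱ hr) (fun j ω => W (r (j + 1)) ω - W (r j) ω) where
  measurable j := hW.measurable_increment (hr j.le_succ)
  memLp j := hW.memLp_increment (hr j.le_succ) 2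
  indep j := hW.indep _ _ (hr j.le_succ)
  integral_eq_zero j := hW.integral_increment (hr j.le_succ)

theorem isInnovationSeq_sq_increment (hW : IsWienerProcess P ℱ W) (hr : Monotone r) :
    IsInnovationSeq P (sampledFiltration ℱ hr)
      (fun j ω => (W (r (j + 1)) ω - W (r j) ω) ^ 2 - ((r (j + 1) : ℝ) - r j)) where
  measurable j := ((hW.measurable_increment (hr j.le_succ)).pow_const 2).sub_const _
  memLp j := hW.memLp_sq_increment (hr j.le_succ)
  indep j := by
    refine indep_of_indep_of_le_left (hW.indep _ _ (hr j.le_succ)) ?_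
    exact Measurable.comap_le
      (((comap_measurable (fun ω => W (r (j + 1)) ω - W (r j) ω)).pow_const 2).sub_const _)
  integral_eq_zero j := hW.integral_sq_increment_sub (hr j.le_succ)

end IsWienerProcess

section Partitions

theorem sum_range_sum_Ico {M : Type*} [AddCommMonoid M] (h : ℕ → M) {p : ℕ → ℕ} (hp : Monotone p)
    (hp0 : p 0 = 0) (N : ℕ) :
    ∑ i ∈ Finset.range N, ∑ j ∈ Finset.Ico (p i) (p (i + 1)), h j
      = ∑ j ∈ Finset.range (p N), h j := by
  induction N with
  | zero => simp [hp0]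
  | succ N ih =>
    rw [Finset.sum_range_succ, ih, Finset.range_eq_Ico, Finset.range_eq_Ico,
      Finset.sum_Ico_consecutive h (Nat.zero_le _) (hp N.le_succ)]

/-- The subdivision of every interval of the partition `s` into `m + 1` equal parts, so that the
`i`-th point of `s` is the `i * (m + 1)`-th point of the refinement. -/
noncomputable def refinePartition (s : ℕ → ℝ≥0) (m j : ℕ) : ℝ≥0 :=
  s (j / (m + 1)) + ((j % (m + 1) : ℕ) : ℝ≥0) / ((m : ℝ≥0) + 1)
    * (s (j / (m + 1) + 1) - s (j / (m + 1)))

theorem refinePartition_mul (s : ℕ → ℝ≥0) (m i : ℕ) :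
    refinePartition s m (i * (m + 1)) = s i := by
  simp [refinePartition]

theorem refinePartition_succ {s : ℕ → ℝ≥0} (hs : Monotone s) (m j : ℕ) :
    refinePartition s m (j + 1) = refinePartition s m j
      + (s (j / (m + 1) + 1) - s (j / (m + 1))) / ((m : ℝ≥0) + 1) := by
  have hmod : j % (m + 1) < m + 1 := Nat.mod_lt j m.succ_pos
  obtain hlast | hlast := (Nat.lt_succ_iff.1 hmod).eq_or_lt
  · have hsucc : j + 1 = (j / (m + 1) + 1) * (m + 1) := by
      have := Nat.div_add_mod' j (m + 1)
      rw [add_mul]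
      omega
    have hpart : (m : ℝ≥0) / ((m : ℝ≥0) + 1) * (s (j / (m + 1) + 1) - s (j / (m + 1)))
        + (s (j / (m + 1) + 1) - s (j / (m + 1))) / ((m : ℝ≥0) + 1)
          = s (j / (m + 1) + 1) - s (j / (m + 1)) := by
      field_simp
    rw [hsucc, refinePartition_mul, refinePartition, hlast, add_assoc, hpart,
      add_tsub_cancel_of_le (hs (Nat.le_succ _))]
  · obtain ⟨hdiv, hmod_succ⟩ : (j + 1) / (m + 1) = j / (m + 1) ∧
        (j + 1) % (m + 1) = j % (m + 1) + 1 := (Nat.div_mod_unique m.succ_pos).2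
      ⟨by rw [add_right_comm, Nat.mod_add_div], Nat.succ_lt_succ hlast⟩
    rw [refinePartition, refinePartition, hdiv, hmod_succ]
    push_cast
    ring

theorem refinePartition_monotone {s : ℕ → ℝ≥0} (hs : Monotone s) (m : ℕ) :
    Monotone (refinePartition s m) :=
  monotone_nat_of_le_succ fun j => (refinePartition_succ hs m j).symm ▸ le_self_add

theorem isPartitionSeq_refinePartition {s : ℕ → ℝ≥0} (hs : Monotone s) (hs0 : s 0 = 0) (i : ℕ) :
    IsPartitionSeq (s i) (fun m => i * (m + 1)) (refinePartition s) where
  mono m := refinePartition_monotone hs m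
  start m := by simpa [hs0] using refinePartition_mul s m 0
  finish m := refinePartition_mul s m i
  mesh δ hδ := by
    have hlim : Tendsto (fun m : ℕ => s i / ((m : ℝ≥0) + 1)) atTop (𝓝 0) := by
      simpa [div_eq_mul_inv] using
        tendsto_one_div_add_atTop_nhds_zero_nat (𝕜 := ℝ≥0).const_mul (s i)
    filter_upwards [hlim.eventually (gt_mem_nhds hδ)] with m hm j hj
    have hblock : j / (m + 1) + 1 ≤ i := (Nat.div_lt_iff_lt_mul m.succ_pos).2 hj
    calc refinePartition s m (j + 1)
        ≤ refinePartition s m j + s i / ((m : ℝ≥0) + 1) := by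
          rw [refinePartition_succ hs]
          gcongr
          exact tsub_le_self.trans (hs hblock)
      _ ≤ refinePartition s m j + δ := by gcongr

namespace IsPartitionSeq

variable {t : ℝ≥0} {N : ℕ → ℕ} {s : ℕ → ℕ → ℝ≥0}

theorem le (h : IsPartitionSeq t N s) {n i : ℕ} (hi : i ≤ N n) : s n i ≤ t :=
  h.finish n ▸ h.mono n hi

theorem comp (h : IsPartitionSeq t N s) {ns : ℕ → ℕ} (hns : StrictMono ns) :
    IsPartitionSeq t (N ∘ ns) (s ∘ ns) where
  mono _ := h.mono _
  start _ := h.start _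
  finish _ := h.finish _
  mesh δ hδ := hns.tendsto_atTop.eventually (h.mesh δ hδ)

theorem sub_nonneg (h : IsPartitionSeq t N s) (n i : ℕ) : 0 ≤ (s n (i + 1) : ℝ) - s n i :=
  _root_.sub_nonneg.2 (NNReal.coe_le_coe.2 (h.mono n i.le_succ))

theorem sum_sub (h : IsPartitionSeq t N s) (n : ℕ) :
    ∑ i ∈ Finset.range (N n), ((s n (i + 1) : ℝ) - s n i) = t := by
  rw [Finset.sum_range_sub (fun i => (s n i : ℝ)), h.finish, h.start, NNReal.coe_zero, sub_zero]

theorem tendsto_sum_sq (h : IsPartitionSeq t N s) :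
    Tendsto (fun n => ∑ i ∈ Finset.range (N n), ((s n (i + 1) : ℝ) - s n i) ^ 2) atTop (𝓝 0) := by
  rw [Metric.tendsto_atTop']
  intro ε hε
  obtain ⟨δ, hδ, hδε⟩ := exists_pos_mul_lt hε (t : ℝ)
  obtain ⟨n₀, hn₀⟩ := eventually_atTop.1 (h.mesh ⟨δ, hδ.le⟩ hδ)
  refine ⟨n₀, fun n hn => ?_⟩
  rw [Real.dist_eq, sub_zero, abs_of_nonneg (Finset.sum_nonneg fun i _ => sq_nonneg _)]
  refine lt_of_le_of_lt ?_ hδε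
  rw [← h.sum_sub n, Finset.sum_mul]
  refine Finset.sum_le_sum fun i hi => ?_
  have hmesh : (s n (i + 1) : ℝ) ≤ s n i + δ :=
    NNReal.coe_le_coe.2 (hn₀ n (le_of_lt hn) i (Finset.mem_range.1 hi))
  rw [sq]
  exact mul_le_mul_of_nonneg_left (sub_le_iff_le_add'.2 hmesh) (h.sub_nonneg n i)

end IsPartitionSeq

end Partitions

section ContinuousOnIic

variable {t : ℝ≥0} {φ : ℝ≥0 → ℝ}

theorem isCompact_Iic {α : Type*} [Preorder α] [OrderBot α] [TopologicalSpace α]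
    [CompactIccSpace α] (a : α) : IsCompact (Set.Iic a) :=
  Set.Icc_bot (a := a) ▸ isCompact_Icc

theorem exists_pos_forall_le_abs_le (h : ContinuousOn φ (Set.Iic t)) :
    ∃ C : ℝ, 0 < C ∧ ∀ r ≤ t, |φ r| ≤ C := by
  obtain ⟨C, hC⟩ := (isCompact_Iic t).exists_bound_of_continuousOn h
  exact ⟨max C 1, by positivity, fun r hr => (hC r hr).trans (le_max_left _ _)⟩

theorem exists_pos_forall_abs_sub_le (h : ContinuousOn φ (Set.Iic t)) {δ : ℝ} (hδ : 0 < δ) :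
    ∃ η : ℝ≥0, 0 < η ∧ ∀ r s, r ≤ s → s ≤ t → s ≤ r + η → |φ s - φ r| ≤ δ := by
  have hunif := (isCompact_Iic t).uniformContinuousOn_of_continuous h
  obtain ⟨η, hη, hφ⟩ := Metric.uniformContinuousOn_iff_le.1 hunif δ hδ
  refine ⟨⟨η, hη.le⟩, hη, fun r s hrs hst hs => hφ s hst r (hrs.trans hst) ?_⟩
  rw [NNReal.dist_eq, abs_of_nonneg (sub_nonneg.2 (NNReal.coe_le_coe.2 hrs)), sub_le_iff_le_add']
  exact NNReal.coe_le_coe.2 hs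

theorem continuousOn_comp_toNNReal (h : ContinuousOn φ (Set.Iic t)) :
    ContinuousOn (fun r : ℝ => φ r.toNNReal) (Set.Iic (t : ℝ)) :=
  h.comp continuous_real_toNNReal.continuousOn fun _ hr => Real.toNNReal_le_iff_le_coe.2 hr

theorem intervalIntegrable_comp_toNNReal (h : ContinuousOn φ (Set.Iic t)) {p q : ℝ≥0} (hp : p ≤ t)
    (hq : q ≤ t) : IntervalIntegrable (fun r : ℝ => φ r.toNNReal) volume p q :=
  ((continuousOn_comp_toNNReal h).mono fun _ hr => (Set.mem_uIcc.1 hr).elim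
    (fun h => h.2.trans (NNReal.coe_le_coe.2 hq))
    fun h => h.2.trans (NNReal.coe_le_coe.2 hp)).intervalIntegrable

end ContinuousOnIic

section Processes

variable {Ω : Type*} {mΩ : MeasurableSpace Ω} {P : Measure Ω} {ℱ : Filtration ℝ≥0 mΩ}
  {τ : Ω → WithTop ℝ≥0} {X A : ℝ≥0 → Ω → ℝ} {t : ℝ≥0}

/-- The event that the lifetime `τ` exceeds `t`, in the form in which it enters
`IsItoIntegralAt` and `IsItoSolution`. -/
abbrev alive (τ : Ω → WithTop ℝ≥0) (t : ℝ≥0) : Set Ω := {ω | (t : WithTop ℝ≥0) < τ ω}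

theorem alive_antitone (τ : Ω → WithTop ℝ≥0) : Antitone (alive τ) :=
  fun _ _ hst _ hω => (WithTop.coe_le_coe.2 hst).trans_lt hω

/-- `X` is an adapted process with continuous paths up to the stopping time `τ`; its values from
time `τ` on play no role. -/
structure IsContinuousAdapted (ℱ : Filtration ℝ≥0 mΩ) (τ : Ω → WithTop ℝ≥0)
    (X : ℝ≥0 → Ω → ℝ) : Prop where
  isStoppingTime : IsStoppingTime ℱ τ
  adapted : ∀ t, StronglyMeasurable[ℱ t] ((alive τ t).indicator (X t))
  continuousOn : ∀ ω, ContinuousOn (fun t => X t ω) {t | (t : WithTop ℝ≥0) < τ ω}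

namespace IsContinuousAdapted

theorem measurableSet_alive (hX : IsContinuousAdapted ℱ τ X) (t : ℝ≥0) :
    MeasurableSet (alive τ t) :=
  ℱ.le t _ (hX.isStoppingTime.measurableSet_gt t)

theorem ae_restrict_alive (hX : IsContinuousAdapted ℱ τ X) {p : Ω → Prop}
    (h : ∀ ω ∈ alive τ t, p ω) : ∀ᵐ ω ∂P.restrict (alive τ t), p ω :=
  (ae_restrict_iff' (hX.measurableSet_alive t)).2 (ae_of_all _ h)

theorem measurable_indicator (hX : IsContinuousAdapted ℱ τ X) {s r : ℝ≥0} (hsr : s ≤ r) :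
    Measurable[ℱ r] ((alive τ r).indicator (X s)) := by
  have hs : Measurable[ℱ r] ((alive τ s).indicator (X s)) :=
    (hX.adapted s).measurable.mono (ℱ.mono hsr) le_rfl
  have hr := hs.indicator (hX.isStoppingTime.measurableSet_gt r)
  rwa [Set.indicator_indicator, Set.inter_eq_left.2 (alive_antitone τ hsr)] at hr

theorem aestronglyMeasurable (hX : IsContinuousAdapted ℱ τ X) {s : ℝ≥0} (hst : s ≤ t) :
    AEStronglyMeasurable (X s) (P.restrict (alive τ t)) :=
  ((hX.measurable_indicator hst).mono (ℱ.le t) le_rfl).aestronglyMeasurable.congr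
    (indicator_ae_eq_restrict (hX.measurableSet_alive t))

theorem continuousOn_Iic (hX : IsContinuousAdapted ℱ τ X) {ω : Ω} (hω : ω ∈ alive τ t) :
    ContinuousOn (fun r => X r ω) (Set.Iic t) :=
  (hX.continuousOn ω).mono fun _ hr => alive_antitone τ hr hω

theorem const (hτ : IsStoppingTime ℱ τ) (c : ℝ) : IsContinuousAdapted ℱ τ (fun _ _ => c) where
  isStoppingTime := hτ
  adapted t := stronglyMeasurable_const.indicator (hτ.measurableSet_gt t)
  continuousOn _ := continuousOn_const

theorem sub (hX : IsContinuousAdapted ℱ τ X) (hA : IsContinuousAdapted ℱ τ A) :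
    IsContinuousAdapted ℱ τ (fun t ω => X t ω - A t ω) where
  isStoppingTime := hX.isStoppingTime
  adapted t := by
    have hdiff := (hX.adapted t).sub (hA.adapted t)
    rwa [← Set.indicator_sub'] at hdiff
  continuousOn ω := (hX.continuousOn ω).sub (hA.continuousOn ω)

theorem mul (hX : IsContinuousAdapted ℱ τ X) (hA : IsContinuousAdapted ℱ τ A) :
    IsContinuousAdapted ℱ τ (fun t ω => X t ω * A t ω) where
  isStoppingTime := hX.isStoppingTime
  adapted t := by
    have hprod := (hX.adapted t).mul (hA.adapted t)
    have hind : (alive τ t).indicator (fun ω => X t ω * A t ω)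
        = (alive τ t).indicator (X t) * (alive τ t).indicator (A t) :=
      Set.indicator_mul (alive τ t) (X t) (A t)
    rwa [hind]
  continuousOn ω := (hX.continuousOn ω).mul (hA.continuousOn ω)

theorem comp (hX : IsContinuousAdapted ℱ τ X) {I : Set ℝ} (hI : IsOpen I)
    (hXI : ∀ t, ∀ ω ∈ alive τ t, X t ω ∈ I) {g : ℝ → ℝ} (hg : ContinuousOn g I) :
    IsContinuousAdapted ℱ τ (fun t ω => g (X t ω)) where
  isStoppingTime := hX.isStoppingTime
  adapted t := by
    classical
    have hg_meas : Measurable (I.piecewise g 0) :=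
      hg.measurable_piecewise continuousOn_const hI.measurableSet
    have hind : (alive τ t).indicator (fun ω => g (X t ω)) = (alive τ t).indicator
        (fun ω => I.piecewise g 0 ((alive τ t).indicator (X t) ω)) := by
      refine Set.indicator_congr fun ω hω => ?_
      rw [Set.indicator_of_mem hω, Set.piecewise_eq_of_mem _ _ _ (hXI t ω hω)]
    rw [hind]
    exact ((hg_meas.comp (hX.adapted t).measurable).indicator
      (hX.isStoppingTime.measurableSet_gt t)).stronglyMeasurable
  continuousOn ω := hg.comp (hX.continuousOn ω) fun t ht => hXI t ω ht

theorem pow (hX : IsContinuousAdapted ℱ τ X) (n : ℕ) :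
    IsContinuousAdapted ℱ τ (fun t ω => X t ω ^ n) :=
  hX.comp isOpen_univ (fun _ _ _ => Set.mem_univ _) (continuous_pow n).continuousOn

end IsContinuousAdapted

/-- The process `X` has the stochastic differential `dX = A dt + B dW` on `[0, τ)`. -/
def HasItoDifferential (P : Measure Ω) (W : ℝ≥0 → Ω → ℝ) (τ : Ω → WithTop ℝ≥0)
    (X A B : ℝ≥0 → Ω → ℝ) : Prop :=
  ∀ t : ℝ≥0, IsItoIntegralAt P W B τ t
    (fun ω => X t ω - X 0 ω - ∫ r in (0 : ℝ)..(t : ℝ), A r.toNNReal ω)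

end Processes

section EulerError

variable {Ω : Type*} {mΩ : MeasurableSpace Ω} {P : Measure Ω} {ℱ : Filtration ℝ≥0 mΩ}
  {τ : Ω → WithTop ℝ≥0} {W X A B G : ℝ≥0 → Ω → ℝ} {t : ℝ≥0}

/-- The error of the Euler step for `dX = A dt + B dW` on the `i`-th interval of the partition `s`,
with the drift integrated exactly. -/
noncomputable def eulerError (W X A B : ℝ≥0 → Ω → ℝ) (s : ℕ → ℝ≥0) (i : ℕ) (ω : Ω) : ℝ :=
  X (s (i + 1)) ω - X (s i) ω - (∫ r in (s i : ℝ)..(s (i + 1) : ℝ), A r.toNNReal ω)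
    - B (s i) ω * (W (s (i + 1)) ω - W (s i) ω)

/-- The Riemann sum over the refined partition for the stochastic integral of `B - B (s i)` over the
`i`-th interval of `s`, which the Euler error of `dX = A dt + B dW` is in the limit. -/
noncomputable def refinedError (W B : ℝ≥0 → Ω → ℝ) (s : ℕ → ℝ≥0) (m i : ℕ) (ω : Ω) : ℝ :=
  ∑ j ∈ Finset.Ico (i * (m + 1)) ((i + 1) * (m + 1)),
    (B (refinePartition s m j) ω - B (s i) ω) *
      (W (refinePartition s m (j + 1)) ω - W (refinePartition s m j) ω)

theorem refinedError_eq (W B : ℝ≥0 → Ω → ℝ) (s : ℕ → ℝ≥0) (m i : ℕ) (ω : Ω) :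
    refinedError W B s m i ω =
      (∑ j ∈ Finset.range ((i + 1) * (m + 1)), B (refinePartition s m j) ω *
        (W (refinePartition s m (j + 1)) ω - W (refinePartition s m j) ω))
      - (∑ j ∈ Finset.range (i * (m + 1)), B (refinePartition s m j) ω *
        (W (refinePartition s m (j + 1)) ω - W (refinePartition s m j) ω))
      - B (s i) ω * (W (s (i + 1)) ω - W (s i) ω) := by
  have hle : i * (m + 1) ≤ (i + 1) * (m + 1) := Nat.mul_le_mul_right _ i.le_succ
  have htelescope := Finset.sum_Ico_sub (fun j => W (refinePartition s m j) ω) hle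
  rw [refinePartition_mul, refinePartition_mul] at htelescope
  rw [← htelescope, Finset.mul_sum, ← Finset.sum_Ico_eq_sub _ hle, ← Finset.sum_sub_distrib]
  exact Finset.sum_congr rfl fun j _ => sub_mul _ _ _

theorem refinePartition_le_of_mem {s : ℕ → ℝ≥0} (hs : Monotone s) {m i j : ℕ}
    (hj : j ∈ Finset.Ico (i * (m + 1)) ((i + 1) * (m + 1))) :
    refinePartition s m j ≤ s (i + 1) :=
  refinePartition_mul s m (i + 1) ▸ refinePartition_monotone hs m (Finset.mem_Ico.1 hj).2.le

theorem aestronglyMeasurable_refinedError (hW : IsWienerProcess P ℱ W)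
    (hB : IsContinuousAdapted ℱ τ B) {s : ℕ → ℝ≥0} (hs : Monotone s) {i : ℕ} (hi : s (i + 1) ≤ t)
    (m : ℕ) : AEStronglyMeasurable (refinedError W B s m i) (P.restrict (alive τ t)) := by
  have hW_meas : ∀ r, AEStronglyMeasurable (W r) (P.restrict (alive τ t)) := fun r =>
    ((hW.measurable r).mono (ℱ.le r) le_rfl).aestronglyMeasurable
  exact Finset.aestronglyMeasurable_fun_sum _ fun j hj =>
    ((hB.aestronglyMeasurable ((refinePartition_le_of_mem hs hj).trans hi)).sub
      (hB.aestronglyMeasurable ((hs i.le_succ).trans hi))).mul ((hW_meas _).sub (hW_meas _))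

theorem HasItoDifferential.tendstoInMeasure_refinedError (hX : HasItoDifferential P W τ X A B)
    (hW : IsWienerProcess P ℱ W) (hA : IsContinuousAdapted ℱ τ A) (hB : IsContinuousAdapted ℱ τ B)
    {s : ℕ → ℝ≥0} (hs : Monotone s) (hs0 : s 0 = 0) {i : ℕ} (hi : s (i + 1) ≤ t) :
    TendstoInMeasure (P.restrict (alive τ t)) (fun m => refinedError W B s m i) atTop
      (eulerError W X A B s i) := by
  have := hW.isProbabilityMeasure
  have hle : ∀ k : Fin 2, s (i + k) ≤ t := fun k => (hs (by omega)).trans hi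
  have hriemann : ∀ k : Fin 2, TendstoInMeasure (P.restrict (alive τ t))
      (fun m ω => ∑ j ∈ Finset.range ((i + k) * (m + 1)), B (refinePartition s m j) ω *
        (W (refinePartition s m (j + 1)) ω - W (refinePartition s m j) ω)) atTop
      (fun ω => X (s (i + k)) ω - X 0 ω - ∫ r in (0 : ℝ)..(s (i + k) : ℝ), A r.toNNReal ω) :=
    fun k => tendstoInMeasure_mono_measure
      (Measure.restrict_mono (alive_antitone τ (hle k)) le_rfl)
      (hX (s (i + k)) _ _ (isPartitionSeq_refinePartition hs hs0 (i + k)))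
  have hjoint := tendstoInMeasure_pi hriemann
  refine tendstoInMeasure_of_forall_subseq hjoint (aestronglyMeasurable_refinedError hW hB hs hi) ?_
  refine hB.ae_restrict_alive fun ω hω ns _ hlim => ?_
  have hdrift := intervalIntegral.integral_interval_sub_left
    (intervalIntegrable_comp_toNNReal (hA.continuousOn_Iic hω) zero_le hi)
    (intervalIntegrable_comp_toNNReal (hA.continuousOn_Iic hω) zero_le (hle 0))
  have hdiff := ((tendsto_pi_nhds.1 hlim 1).sub (tendsto_pi_nhds.1 hlim 0)).sub_const
    (B (s i) ω * (W (s (i + 1)) ω - W (s i) ω))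
  simp only [Fin.val_zero, Fin.val_one, add_zero] at hdiff hdrift
  simp only [refinedError_eq]
  convert hdiff using 2
  rw [eulerError, ← hdrift, NNReal.coe_zero]
  ring

/-- The coefficient of the `j`-th increment of `W` over the refined partition in the sum of the
`G (s i) * refinedError W B s m i`, cut off where `τ` has passed so that it is adapted. -/
noncomputable def errorCoeff (τ : Ω → WithTop ℝ≥0) (G B : ℝ≥0 → Ω → ℝ) (s : ℕ → ℝ≥0)
    (m j : ℕ) : Ω → ℝ :=
  (alive τ (refinePartition s m j)).indicator fun ω => G (s (j / (m + 1))) ω *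
    (B (refinePartition s m j) ω - B (s (j / (m + 1))) ω)

theorem measurable_errorCoeff (hG : IsContinuousAdapted ℱ τ G) (hB : IsContinuousAdapted ℱ τ B)
    (s : ℕ → ℝ≥0) (m j : ℕ) : Measurable[ℱ (refinePartition s m j)] (errorCoeff τ G B s m j) := by
  have hle : s (j / (m + 1)) ≤ refinePartition s m j := le_self_add
  have hmul := (hG.measurable_indicator hle).mul
    ((hB.measurable_indicator le_rfl).sub (hB.measurable_indicator hle))
  convert hmul using 1
  ext ω
  by_cases hω : ω ∈ alive τ (refinePartition s m j) <;> simp [errorCoeff, hω]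

theorem errorCoeff_of_mem {s : ℕ → ℝ≥0} {m i j : ℕ} {ω : Ω}
    (hω : ω ∈ alive τ (refinePartition s m j))
    (hj : j ∈ Finset.Ico (i * (m + 1)) ((i + 1) * (m + 1))) :
    errorCoeff τ G B s m j ω = G (s i) ω * (B (refinePartition s m j) ω - B (s i) ω) := by
  have hdiv : j / (m + 1) = i := Nat.div_eq_of_lt_le (Finset.mem_Ico.1 hj).1 (Finset.mem_Ico.1 hj).2
  rw [errorCoeff, Set.indicator_of_mem hω, hdiv]

theorem mul_refinedError {s : ℕ → ℝ≥0} (hs : Monotone s) {i : ℕ} (hi : s (i + 1) ≤ t) {ω : Ω}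
    (hω : ω ∈ alive τ t) (m : ℕ) :
    G (s i) ω * refinedError W B s m i ω
      = ∑ j ∈ Finset.Ico (i * (m + 1)) ((i + 1) * (m + 1)), errorCoeff τ G B s m j ω *
        (W (refinePartition s m (j + 1)) ω - W (refinePartition s m j) ω) := by
  rw [refinedError, Finset.mul_sum]
  refine Finset.sum_congr rfl fun j hj => ?_
  have hjt := (refinePartition_le_of_mem hs hj).trans hi
  rw [errorCoeff_of_mem (alive_antitone τ hjt hω) hj, mul_assoc]

namespace IsPartitionSeq

variable {N : ℕ → ℕ} {s : ℕ → ℕ → ℝ≥0}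

theorem eventually_abs_errorCoeff_le (hs : IsPartitionSeq t N s) (hG : IsContinuousAdapted ℱ τ G)
    (hB : IsContinuousAdapted ℱ τ B) (k : ℕ → ℕ) {ω : Ω} (hω : ω ∈ alive τ t) {δ : ℝ}
    (hδ : 0 < δ) : ∀ᶠ n in atTop, ∀ i < N n,
      ∀ j ∈ Finset.Ico (i * (k n + 1)) ((i + 1) * (k n + 1)),
        |errorCoeff τ G B (s n) (k n) j ω| ≤ δ := by
  obtain ⟨C, hC, hGC⟩ := exists_pos_forall_le_abs_le (hG.continuousOn_Iic hω)
  obtain ⟨η, hη, hBη⟩ := exists_pos_forall_abs_sub_le (hB.continuousOn_Iic hω) (div_pos hδ hC)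
  filter_upwards [hs.mesh η hη] with n hn i hi j hj
  have hle_succ : refinePartition (s n) (k n) j ≤ s n (i + 1) :=
    refinePartition_le_of_mem (hs.mono n) hj
  have hle : s n i ≤ refinePartition (s n) (k n) j := refinePartition_mul (s n) (k n) i ▸
    refinePartition_monotone (hs.mono n) (k n) (Finset.mem_Ico.1 hj).1
  have hlt : refinePartition (s n) (k n) j ≤ t := hle_succ.trans (hs.le hi)
  rw [errorCoeff_of_mem (alive_antitone τ hlt hω) hj, abs_mul]
  calc |G (s n i) ω| * |B (refinePartition (s n) (k n) j) ω - B (s n i) ω|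
      ≤ C * (δ / C) := mul_le_mul (hGC _ (hs.le hi.le))
        (hBη _ _ hle hlt (hle_succ.trans (hn i hi))) (abs_nonneg _) hC.le
    _ = δ := mul_div_cancel₀ δ hC.ne'

theorem sum_integral_sq_increment (hs : IsPartitionSeq t N s) (hW : IsWienerProcess P ℱ W)
    (k : ℕ → ℕ) (n : ℕ) :
    ∑ j ∈ Finset.range (N n * (k n + 1)), ∫ ω, (W (refinePartition (s n) (k n) (j + 1)) ω
      - W (refinePartition (s n) (k n) j) ω) ^ 2 ∂P = t := by
  have hr := isPartitionSeq_refinePartition (hs.mono n) (hs.start n) (N n)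
  rw [hs.finish] at hr
  rw [← hr.sum_sub (k n)]
  exact Finset.sum_congr rfl fun j _ => hW.integral_sq_increment (hr.mono _ j.le_succ)

end IsPartitionSeq

namespace HasItoDifferential

variable {N : ℕ → ℕ} {s : ℕ → ℕ → ℝ≥0}

theorem tendstoInMeasure_sum_mul_eulerError (hX : HasItoDifferential P W τ X A B)
    (hW : IsWienerProcess P ℱ W) (hA : IsContinuousAdapted ℱ τ A) (hB : IsContinuousAdapted ℱ τ B)
    (hG : IsContinuousAdapted ℱ τ G) (hs : IsPartitionSeq t N s) :
    TendstoInMeasure (P.restrict (alive τ t)) (fun n ω => ∑ i ∈ Finset.range (N n),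
      G (s n i) ω * eulerError W X A B (s n) i ω) atTop (fun _ => 0) := by
  have := hW.isProbabilityMeasure
  refine tendstoInMeasure_zero_of_diagonal (F := fun n m ω => ∑ i ∈ Finset.range (N n),
      G (s n i) ω * refinedError W B (s n) m i ω) (fun n => ?_) fun k => ?_
  · have hjoint := tendstoInMeasure_pi fun i : Fin (N n) =>
      hX.tendstoInMeasure_refinedError hW hA hB (hs.mono n) (hs.start n) (hs.le i.2)
    refine tendstoInMeasure_of_forall_subseq hjoint
      (fun m => Finset.aestronglyMeasurable_fun_sum _ fun i hi => ?_)
      (ae_of_all _ fun ω ns _ hlim => tendsto_finsetSum _ fun i hi =>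
        (tendsto_pi_nhds.1 hlim ⟨i, Finset.mem_range.1 hi⟩).const_mul _)
    have hi' := Finset.mem_range.1 hi
    exact (hG.aestronglyMeasurable (hs.le hi'.le)).mul
      (aestronglyMeasurable_refinedError hW hB (hs.mono n) (hs.le hi') m)
  · refine (tendstoInMeasure_sum_mul_innovation
      (fun n => hW.isInnovationSeq_increment (refinePartition_monotone (hs.mono n) (k n)))
      (fun n j => measurable_errorCoeff hG hB (s n) (k n) j)
      (fun n => (hs.sum_integral_sq_increment hW k n).le) (hB.measurableSet_alive t)
      fun ω hω δ hδ => ?_).congr_left fun n => hB.ae_restrict_alive fun ω hω => ?_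
    · filter_upwards [hs.eventually_abs_errorCoeff_le hG hB k hω hδ] with n hn j hj
      exact hn (j / (k n + 1)) ((Nat.div_lt_iff_lt_mul (k n).succ_pos).2 hj) j
        (Finset.mem_Ico.2 ⟨Nat.div_mul_le_self _ _, (Nat.div_lt_iff_lt_mul (k n).succ_pos).1
          (Nat.lt_succ_self _)⟩)
    · rw [← sum_range_sum_Ico _ (fun _ _ h => Nat.mul_le_mul_right (k n + 1) h) (zero_mul _)]
      exact Finset.sum_congr rfl fun i hi =>
        (mul_refinedError (hs.mono n) (hs.le (Finset.mem_range.1 hi)) hω (k n)).symm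

theorem tendstoInMeasure_sum_sq_eulerError (hX : HasItoDifferential P W τ X A B)
    (hW : IsWienerProcess P ℱ W) (hA : IsContinuousAdapted ℱ τ A) (hB : IsContinuousAdapted ℱ τ B)
    (hs : IsPartitionSeq t N s) :
    TendstoInMeasure (P.restrict (alive τ t)) (fun n ω => ∑ i ∈ Finset.range (N n),
      eulerError W X A B (s n) i ω ^ 2) atTop (fun _ => 0) := by
  have := hW.isProbabilityMeasure
  have hone : IsContinuousAdapted ℱ τ (fun _ _ => 1) := .const hA.isStoppingTime 1
  refine tendstoInMeasure_zero_of_diagonal (F := fun n m ω => ∑ i ∈ Finset.range (N n),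
      refinedError W B (s n) m i ω ^ 2) (fun n => ?_) fun k => ?_
  · have hjoint := tendstoInMeasure_pi fun i : Fin (N n) =>
      hX.tendstoInMeasure_refinedError hW hA hB (hs.mono n) (hs.start n) (hs.le i.2)
    exact tendstoInMeasure_of_forall_subseq hjoint
      (fun m => Finset.aestronglyMeasurable_fun_sum _ fun i hi =>
        (aestronglyMeasurable_refinedError hW hB (hs.mono n) (hs.le (Finset.mem_range.1 hi)) m).pow
          2)
      (ae_of_all _ fun ω ns _ hlim => tendsto_finsetSum _ fun i hi =>
        (tendsto_pi_nhds.1 hlim ⟨i, Finset.mem_range.1 hi⟩).pow 2)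
  · refine (tendstoInMeasure_sum_sq_sum_mul
      (fun n => hW.isInnovationSeq_increment (refinePartition_monotone (hs.mono n) (k n)))
      (fun n j => measurable_errorCoeff hone hB (s n) (k n) j) (C := t)
      (J := fun n i => Finset.Ico (i * (k n + 1)) ((i + 1) * (k n + 1))) (fun n => ?_)
      (hB.measurableSet_alive t)
      fun ω hω δ hδ => hs.eventually_abs_errorCoeff_le hone hB k hω hδ).congr_left
      fun n => hB.ae_restrict_alive fun ω hω => Finset.sum_congr rfl fun i hi => ?_
    · rw [← hs.sum_integral_sq_increment hW k n,
        sum_range_sum_Ico _ (fun _ _ h => Nat.mul_le_mul_right (k n + 1) h) (zero_mul _)]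
    · rw [← mul_refinedError (hs.mono n) (hs.le (Finset.mem_range.1 hi)) hω (k n), one_mul]

end HasItoDifferential

end EulerError

section RiemannSums

theorem abs_sum_mul_add_sq_sub_le {κ : Type*} {F : Finset κ} {φ p e : κ → ℝ} {C : ℝ}
    (hφ : ∀ i ∈ F, |φ i| ≤ C) :
    |∑ i ∈ F, φ i * (p i + e i) ^ 2 - ∑ i ∈ F, φ i * p i ^ 2|
      ≤ C * (2 * (√(∑ i ∈ F, p i ^ 2) * √(∑ i ∈ F, e i ^ 2)) + ∑ i ∈ F, e i ^ 2) := by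
  obtain rfl | ⟨i₀, hi₀⟩ := F.eq_empty_or_nonempty
  · simp
  have hC : 0 ≤ C := (abs_nonneg _).trans (hφ i₀ hi₀)
  have hterm : ∀ i ∈ F, |φ i * (p i + e i) ^ 2 - φ i * p i ^ 2|
      ≤ C * (2 * (|p i| * |e i|) + e i ^ 2) := by
    intro i hi
    calc |φ i * (p i + e i) ^ 2 - φ i * p i ^ 2|
        = |φ i| * |2 * (p i * e i) + e i ^ 2| := by rw [← abs_mul]; congr 1; ring
      _ ≤ C * (|2 * (p i * e i)| + |e i ^ 2|) :=
          mul_le_mul (hφ i hi) (abs_add_le _ _) (abs_nonneg _) hC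
      _ = C * (2 * (|p i| * |e i|) + e i ^ 2) := by
          rw [abs_mul, abs_mul, abs_two, abs_pow, sq_abs]
  have hcauchy := Real.sum_mul_le_sqrt_mul_sqrt F (fun i => |p i|) (fun i => |e i|)
  simp only [sq_abs] at hcauchy
  rw [← Finset.sum_sub_distrib]
  refine (Finset.abs_sum_le_sum_abs _ _).trans ((Finset.sum_le_sum hterm).trans ?_)
  rw [← Finset.mul_sum, Finset.sum_add_distrib, ← Finset.mul_sum]
  gcongr

section Perturbation

variable {ι κ : Type*} {l : Filter ι} {F : ι → Finset κ} {φ p e : ι → κ → ℝ} {C L L' : ℝ}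

theorem tendsto_sum_mul_add_sq (hφ : ∀ n, ∀ i ∈ F n, |φ n i| ≤ C)
    (he : Tendsto (fun n => ∑ i ∈ F n, e n i ^ 2) l (𝓝 0))
    (hp : Tendsto (fun n => ∑ i ∈ F n, p n i ^ 2) l (𝓝 L'))
    (hφp : Tendsto (fun n => ∑ i ∈ F n, φ n i * p n i ^ 2) l (𝓝 L)) :
    Tendsto (fun n => ∑ i ∈ F n, φ n i * (p n i + e n i) ^ 2) l (𝓝 L) := by
  have hbound := ((((hp.sqrt).mul (he.sqrt)).const_mul 2).add he).const_mul C
  simp only [Real.sqrt_zero, mul_zero, add_zero] at hbound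
  have hsub : Tendsto (fun n => ∑ i ∈ F n, φ n i * (p n i + e n i) ^ 2
      - ∑ i ∈ F n, φ n i * p n i ^ 2) l (𝓝 0) :=
    squeeze_zero_norm (fun n => abs_sum_mul_add_sq_sub_le (hφ n)) hbound
  simpa using hsub.add hφp

theorem tendsto_sum_add_sq (he : Tendsto (fun n => ∑ i ∈ F n, e n i ^ 2) l (𝓝 0))
    (hp : Tendsto (fun n => ∑ i ∈ F n, p n i ^ 2) l (𝓝 L)) :
    Tendsto (fun n => ∑ i ∈ F n, (p n i + e n i) ^ 2) l (𝓝 L) := by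
  simpa using
    tendsto_sum_mul_add_sq (φ := fun _ _ => 1) (C := 1) (by simp) he hp (by simpa using hp)

end Perturbation

section Taylor

variable {f f' f'' : ℝ → ℝ} {p q c C η : ℝ}

theorem abs_sub_sub_mul_le (hf : ∀ z ∈ Set.uIcc p q, HasDerivAt f (f' z) z)
    (hC : ∀ z ∈ Set.uIcc p q, |f' z - c| ≤ C) : |f q - f p - c * (q - p)| ≤ C * |q - p| := by
  have hmean := (convex_uIcc p q).norm_image_sub_le_of_norm_hasDerivWithin_le
    (f := fun z => f z - c * z) (f' := fun z => f' z - c)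
    (fun z hz => ((hf z hz).sub ((hasDerivAt_id z).const_mul c)).hasDerivWithinAt.congr_deriv
      (by rw [mul_one])) hC Set.left_mem_uIcc Set.right_mem_uIcc
  rw [Real.norm_eq_abs, Real.norm_eq_abs] at hmean
  convert hmean using 2
  ring

theorem abs_taylor_two_le (hf : ∀ z ∈ Set.uIcc p q, HasDerivAt f (f' z) z)
    (hf' : ∀ z ∈ Set.uIcc p q, HasDerivAt f' (f'' z) z)
    (hη : ∀ z ∈ Set.uIcc p q, |f'' z - f'' p| ≤ η) :
    |f q - f p - f' p * (q - p) - 1 / 2 * f'' p * (q - p) ^ 2| ≤ η * (q - p) ^ 2 := by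
  have hη_nonneg : 0 ≤ η := (abs_nonneg _).trans (hη p Set.left_mem_uIcc)
  have hfirst : ∀ z ∈ Set.uIcc p q, |f' z - f'' p * (z - p) - f' p| ≤ η * |q - p| := by
    intro z hz
    have hsub : Set.uIcc p z ⊆ Set.uIcc p q := Set.uIcc_subset_uIcc_left hz
    calc |f' z - f'' p * (z - p) - f' p| = |f' z - f' p - f'' p * (z - p)| := by
          rw [sub_right_comm]
      _ ≤ η * |z - p| :=
          abs_sub_sub_mul_le (fun w hw => hf' w (hsub hw)) fun w hw => hη w (hsub hw)
      _ ≤ η * |q - p| := by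
          gcongr ?_ * ?_
          exact Set.abs_sub_left_of_mem_uIcc hz
  have hderiv : ∀ z ∈ Set.uIcc p q, HasDerivAt (fun z => f z - 1 / 2 * f'' p * (z - p) ^ 2)
      (f' z - f'' p * (z - p)) z := fun z hz => by
    refine ((hf z hz).sub
      ((((hasDerivAt_id z).sub_const p).pow 2).const_mul (1 / 2 * f'' p))).congr_deriv ?_
    simp only [id_eq, Nat.cast_ofNat, Nat.add_one_sub_one, pow_one, mul_one]
    ring
  have hsecond := abs_sub_sub_mul_le hderiv hfirst
  rw [mul_assoc η, abs_mul_abs_self, ← sq] at hsecond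
  convert hsecond using 2
  ring

end Taylor

theorem abs_integral_comp_toNNReal_le {φ : ℝ≥0 → ℝ} {p q : ℝ≥0} (hpq : p ≤ q) {C : ℝ}
    (hφ : ∀ r, p ≤ r → r ≤ q → |φ r| ≤ C) :
    |∫ r in (p : ℝ)..(q : ℝ), φ r.toNNReal| ≤ C * (q - p) := by
  have hpq' : (p : ℝ) ≤ q := NNReal.coe_le_coe.2 hpq
  have hbound := intervalIntegral.norm_integral_le_of_norm_le_const (C := C) (a := (p : ℝ)) (b := q)
    (f := fun r : ℝ => φ r.toNNReal) fun r hr => by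
      rw [Set.uIoc_of_le hpq'] at hr
      exact hφ _ (NNReal.le_toNNReal_of_coe_le hr.1.le) (Real.toNNReal_le_iff_le_coe.2 hr.2)
  rwa [abs_of_nonneg (sub_nonneg.2 hpq')] at hbound

namespace IsPartitionSeq

variable {t : ℝ≥0} {N : ℕ → ℕ} {s : ℕ → ℕ → ℝ≥0} {φ ψ : ℝ≥0 → ℝ}

theorem sum_integral (hs : IsPartitionSeq t N s) (hφ : ContinuousOn φ (Set.Iic t)) (n : ℕ) :
    ∑ i ∈ Finset.range (N n), ∫ r in (s n i : ℝ)..(s n (i + 1) : ℝ), φ r.toNNReal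
      = ∫ r in (0 : ℝ)..(t : ℝ), φ r.toNNReal := by
  have hsum := intervalIntegral.sum_integral_adjacent_intervals (μ := volume)
    (f := fun r : ℝ => φ r.toNNReal) (a := fun i => (s n i : ℝ)) (n := N n)
    fun i hi => intervalIntegrable_comp_toNNReal hφ (hs.le hi.le) (hs.le hi)
  rwa [hs.start, hs.finish, NNReal.coe_zero] at hsum

theorem tendsto_sum_mul_integral (hs : IsPartitionSeq t N s) (hφ : ContinuousOn φ (Set.Iic t))
    (hψ : ContinuousOn ψ (Set.Iic t)) :
    Tendsto (fun n => ∑ i ∈ Finset.range (N n),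
      φ (s n i) * ∫ r in (s n i : ℝ)..(s n (i + 1) : ℝ), ψ r.toNNReal) atTop
      (𝓝 (∫ r in (0 : ℝ)..(t : ℝ), φ r.toNNReal * ψ r.toNNReal)) := by
  rw [Metric.tendsto_atTop']
  intro ε hε
  obtain ⟨C, -, hψC⟩ := exists_pos_forall_le_abs_le hψ
  obtain ⟨δ, hδ, hδε⟩ := exists_pos_mul_lt hε (C * t)
  obtain ⟨η, hη, hφη⟩ := exists_pos_forall_abs_sub_le hφ hδ
  obtain ⟨n₀, hn₀⟩ := eventually_atTop.1 (hs.mesh η hη)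
  refine ⟨n₀, fun n hn => ?_⟩
  have hφψ : ContinuousOn (fun r => φ r * ψ r) (Set.Iic t) := hφ.mul hψ
  have hinterval : ∀ i ∈ Finset.range (N n),
      |φ (s n i) * (∫ r in (s n i : ℝ)..(s n (i + 1) : ℝ), ψ r.toNNReal)
        - ∫ r in (s n i : ℝ)..(s n (i + 1) : ℝ), φ r.toNNReal * ψ r.toNNReal|
      ≤ δ * C * ((s n (i + 1) : ℝ) - s n i) := by
    intro i hi
    have hi' := Finset.mem_range.1 hi
    rw [← intervalIntegral.integral_const_mul, ← intervalIntegral.integral_sub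
      ((intervalIntegrable_comp_toNNReal hψ (hs.le hi'.le) (hs.le hi')).const_mul _)
      (intervalIntegrable_comp_toNNReal hφψ (hs.le hi'.le) (hs.le hi'))]
    refine abs_integral_comp_toNNReal_le (φ := fun r => φ (s n i) * ψ r - φ r * ψ r)
      (hs.mono n i.le_succ) fun r hir hri => ?_
    have hrt : r ≤ t := hri.trans (hs.le hi')
    rw [← sub_mul, abs_mul, abs_sub_comm]
    exact mul_le_mul (hφη _ _ hir hrt (hri.trans (hn₀ n hn.le i hi'))) (hψC r hrt) (abs_nonneg _)
      hδ.le
  rw [← hs.sum_integral hφψ n, Real.dist_eq, ← Finset.sum_sub_distrib]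
  calc _ ≤ ∑ i ∈ Finset.range (N n), δ * C * ((s n (i + 1) : ℝ) - s n i) :=
        (Finset.abs_sum_le_sum_abs _ _).trans (Finset.sum_le_sum hinterval)
    _ = C * t * δ := by rw [← Finset.mul_sum, hs.sum_sub]; ring
    _ < ε := hδε

theorem tendsto_riemannSum (hs : IsPartitionSeq t N s) (hφ : ContinuousOn φ (Set.Iic t)) :
    Tendsto (fun n => ∑ i ∈ Finset.range (N n), φ (s n i) * ((s n (i + 1) : ℝ) - s n i)) atTop
      (𝓝 (∫ r in (0 : ℝ)..(t : ℝ), φ r.toNNReal)) := by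
  simpa using hs.tendsto_sum_mul_integral hφ (ψ := fun _ => 1) continuousOn_const

theorem tendsto_sum_sq_integral (hs : IsPartitionSeq t N s) (hψ : ContinuousOn ψ (Set.Iic t)) :
    Tendsto (fun n => ∑ i ∈ Finset.range (N n),
      (∫ r in (s n i : ℝ)..(s n (i + 1) : ℝ), ψ r.toNNReal) ^ 2) atTop (𝓝 0) := by
  obtain ⟨C, -, hψC⟩ := exists_pos_forall_le_abs_le hψ
  have hmesh := hs.tendsto_sum_sq.const_mul (C ^ 2)
  rw [mul_zero] at hmesh
  refine squeeze_zero (fun n => Finset.sum_nonneg fun i _ => sq_nonneg _) (fun n => ?_) hmesh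
  rw [Finset.mul_sum]
  refine Finset.sum_le_sum fun i hi => ?_
  rw [← mul_pow, ← sq_abs]
  gcongr
  exact abs_integral_comp_toNNReal_le (hs.mono n i.le_succ) fun r _ hr =>
    hψC r (hr.trans (hs.le (Finset.mem_range.1 hi)))

theorem tendsto_sum_taylor_two (hs : IsPartitionSeq t N s) {I : Set ℝ} {f f' f'' : ℝ → ℝ}
    (hf : ∀ z ∈ I, HasDerivAt f (f' z) z) (hf' : ∀ z ∈ I, HasDerivAt f' (f'' z) z)
    (hf'' : ContinuousOn f'' I) {y : ℝ≥0 → ℝ} (hy : ContinuousOn y (Set.Iic t))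
    (hyI : ∀ r ≤ t, y r ∈ I) {L : ℝ}
    (hL : Tendsto (fun n => ∑ i ∈ Finset.range (N n), (y (s n (i + 1)) - y (s n i)) ^ 2) atTop
      (𝓝 L)) :
    Tendsto (fun n => ∑ i ∈ Finset.range (N n), (f (y (s n (i + 1))) - f (y (s n i))
      - f' (y (s n i)) * (y (s n (i + 1)) - y (s n i))
      - 1 / 2 * f'' (y (s n i)) * (y (s n (i + 1)) - y (s n i)) ^ 2)) atTop (𝓝 0) := by
  have hrange : (y '' Set.Iic t).OrdConnected := (isPreconnected_Iic.image y hy).ordConnected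
  have hrangeI : y '' Set.Iic t ⊆ I := Set.image_subset_iff.2 hyI
  have hunif := ((isCompact_Iic t).image_of_continuousOn hy).uniformContinuousOn_of_continuous
    (hf''.mono hrangeI)
  rw [Metric.tendsto_atTop']
  intro ε hε
  obtain ⟨η, hη, hηε⟩ := exists_pos_mul_lt hε (L + 1)
  obtain ⟨δ, hδ, hδη⟩ := Metric.uniformContinuousOn_iff_le.1 hunif η hη
  obtain ⟨θ, hθ, hyθ⟩ := exists_pos_forall_abs_sub_le hy hδ
  obtain ⟨n₀, hn₀⟩ := eventually_atTop.1
    ((hs.mesh θ hθ).and (hL.eventually (gt_mem_nhds (lt_add_one L))))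
  refine ⟨n₀, fun n hn => ?_⟩
  obtain ⟨hmesh, hsum⟩ := hn₀ n hn.le
  have hinterval : ∀ i ∈ Finset.range (N n), |f (y (s n (i + 1))) - f (y (s n i))
      - f' (y (s n i)) * (y (s n (i + 1)) - y (s n i))
      - 1 / 2 * f'' (y (s n i)) * (y (s n (i + 1)) - y (s n i)) ^ 2|
      ≤ η * (y (s n (i + 1)) - y (s n i)) ^ 2 := by
    intro i hi
    have hi' := Finset.mem_range.1 hi
    have hleft : y (s n i) ∈ y '' Set.Iic t := ⟨_, hs.le hi'.le, rfl⟩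
    have hsub := hrange.uIcc_subset hleft ⟨_, hs.le hi', rfl⟩
    refine abs_taylor_two_le (fun z hz => hf z (hrangeI (hsub hz)))
      (fun z hz => hf' z (hrangeI (hsub hz))) fun z hz => hδη z (hsub hz) _ hleft ?_
    exact (Set.abs_sub_left_of_mem_uIcc hz).trans
      (hyθ _ _ (hs.mono n i.le_succ) (hs.le hi') (hmesh i hi'))
  rw [Real.dist_eq, sub_zero]
  calc _ ≤ ∑ i ∈ Finset.range (N n), η * (y (s n (i + 1)) - y (s n i)) ^ 2 :=
        (Finset.abs_sum_le_sum_abs _ _).trans (Finset.sum_le_sum hinterval)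
    _ ≤ (L + 1) * η := by rw [← Finset.mul_sum, mul_comm]; gcongr
    _ < ε := hηε

end IsPartitionSeq

end RiemannSums

section ItoFormula

variable {Ω : Type*} {mΩ : MeasurableSpace Ω} {P : Measure Ω} {ℱ : Filtration ℝ≥0 mΩ}
  {τ : Ω → WithTop ℝ≥0} {W X A B G : ℝ≥0 → Ω → ℝ} {t : ℝ≥0} {N : ℕ → ℕ} {s : ℕ → ℕ → ℝ≥0}

namespace IsPartitionSeq

theorem tendsto_sum_mul_of_sub (hs : IsPartitionSeq t N s) {φ : ℝ≥0 → ℝ}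
    (hφ : ContinuousOn φ (Set.Iic t)) {v : ℕ → ℕ → ℝ}
    (hv : Tendsto (fun n => ∑ i ∈ Finset.range (N n),
      φ (s n i) * (v n i - ((s n (i + 1) : ℝ) - s n i))) atTop (𝓝 0)) :
    Tendsto (fun n => ∑ i ∈ Finset.range (N n), φ (s n i) * v n i) atTop
      (𝓝 (∫ r in (0 : ℝ)..(t : ℝ), φ r.toNNReal)) := by
  have hadd := hv.add (hs.tendsto_riemannSum hφ)
  simpa only [← Finset.sum_add_distrib, ← mul_add, sub_add_cancel, zero_add] using hadd

theorem tendsto_sum_mul_sq_add (hs : IsPartitionSeq t N s) {φ α β : ℝ≥0 → ℝ}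
    (hφ : ContinuousOn φ (Set.Iic t)) (hα : ContinuousOn α (Set.Iic t))
    (hβ : ContinuousOn β (Set.Iic t)) {w e : ℕ → ℕ → ℝ}
    (hφw : Tendsto (fun n => ∑ i ∈ Finset.range (N n),
      (φ (s n i) * β (s n i) ^ 2) * (w n i ^ 2 - ((s n (i + 1) : ℝ) - s n i))) atTop (𝓝 0))
    (hw : Tendsto (fun n => ∑ i ∈ Finset.range (N n),
      β (s n i) ^ 2 * (w n i ^ 2 - ((s n (i + 1) : ℝ) - s n i))) atTop (𝓝 0))
    (he : Tendsto (fun n => ∑ i ∈ Finset.range (N n), e n i ^ 2) atTop (𝓝 0)) :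
    Tendsto (fun n => ∑ i ∈ Finset.range (N n), φ (s n i) * (β (s n i) * w n i
      + ((∫ r in (s n i : ℝ)..(s n (i + 1) : ℝ), α r.toNNReal) + e n i)) ^ 2) atTop
      (𝓝 (∫ r in (0 : ℝ)..(t : ℝ), φ r.toNNReal * β r.toNNReal ^ 2)) := by
  have hdrift := tendsto_sum_add_sq he (hs.tendsto_sum_sq_integral hα)
  have hvol := hs.tendsto_sum_mul_of_sub (φ := fun r => β r ^ 2) (hβ.pow 2) hw
  have hφvol := hs.tendsto_sum_mul_of_sub (φ := fun r => φ r * β r ^ 2) (hφ.mul (hβ.pow 2)) hφw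
  simp only [mul_assoc, ← mul_pow] at hvol hφvol
  obtain ⟨C, -, hC⟩ := exists_pos_forall_le_abs_le hφ
  exact tendsto_sum_mul_add_sq (φ := fun n i => φ (s n i))
    (fun n i hi => hC _ (hs.le (Finset.mem_range.1 hi).le)) hdrift hvol hφvol

/-- The coefficients are normalised by `c n ≥ √(∑ Δt²)`, so that the innovations have bounded total
variance while the coefficients vanish uniformly. -/
theorem tendstoInMeasure_sum_mul_sq_increment (hs : IsPartitionSeq t N s)
    (hW : IsWienerProcess P ℱ W) (hG : IsContinuousAdapted ℱ τ G) :
    TendstoInMeasure (P.restrict (alive τ t)) (fun n ω => ∑ i ∈ Finset.range (N n),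
      G (s n i) ω * ((W (s n (i + 1)) ω - W (s n i) ω) ^ 2 - ((s n (i + 1) : ℝ) - s n i)))
      atTop (fun _ => 0) := by
  have := hW.isProbabilityMeasure
  set q : ℕ → ℝ := fun n => ∑ i ∈ Finset.range (N n), ((s n (i + 1) : ℝ) - s n i) ^ 2
  set c : ℕ → ℝ := fun n => √(q n + 1 / ((n : ℝ) + 1))
  have hq : ∀ n, 0 ≤ q n := fun n => Finset.sum_nonneg fun i _ => sq_nonneg _
  have hc_pos : ∀ n, 0 < c n := fun n =>
    Real.sqrt_pos.2 (add_pos_of_nonneg_of_pos (hq n) Nat.one_div_pos_of_nat)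
  have hqc : ∀ n, (c n)⁻¹ ^ 2 * q n ≤ 1 := fun n => by
    rw [inv_pow, inv_mul_le_one₀ (pow_pos (hc_pos n) 2),
      Real.sq_sqrt (add_nonneg (hq n) Nat.one_div_pos_of_nat.le)]
    exact le_add_of_nonneg_right Nat.one_div_pos_of_nat.le
  have hc : Tendsto c atTop (𝓝 0) := by
    have hsqrt := (hs.tendsto_sum_sq.add tendsto_one_div_add_atTop_nhds_zero_nat).sqrt
    rwa [add_zero, Real.sqrt_zero] at hsqrt
  set V : ℝ := ∫ z, (z ^ 2 - 1) ^ 2 ∂(gaussianReal 0 1)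
  have hV : 0 ≤ V := integral_nonneg fun z => sq_nonneg _
  refine (tendstoInMeasure_sum_mul_innovation
    (fun n => (hW.isInnovationSeq_sq_increment (hs.mono n)).const_mul (c n)⁻¹)
    (ξ := fun n j ω => c n * (alive τ (s n j)).indicator (G (s n j)) ω)
    (fun n j => (hG.measurable_indicator le_rfl).const_mul (c n)) (C := V) (fun n => ?_)
    (hG.measurableSet_alive t) fun ω hω δ hδ => ?_).congr_left
    fun n => hG.ae_restrict_alive fun ω hω => Finset.sum_congr rfl fun i hi => ?_
  · simp only [mul_pow, integral_const_mul,
      hW.integral_sq_sq_increment_sub (hs.mono n (Nat.le_succ _))]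
    rw [← Finset.mul_sum, ← Finset.sum_mul, ← mul_assoc]
    exact mul_le_of_le_one_left hV (hqc n)
  · obtain ⟨C, hC, hGC⟩ := exists_pos_forall_le_abs_le (hG.continuousOn_Iic hω)
    filter_upwards [hc.eventually (gt_mem_nhds (div_pos hδ hC))] with n hn j hj
    rw [Set.indicator_of_mem (alive_antitone τ (hs.le hj.le) hω), abs_mul, abs_of_pos (hc_pos n)]
    calc c n * |G (s n j) ω| ≤ δ / C * C :=
          mul_le_mul hn.le (hGC _ (hs.le hj.le)) (abs_nonneg _) (by positivity)
      _ = δ := div_mul_cancel₀ δ hC.ne'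
  · rw [Set.indicator_of_mem (alive_antitone τ (hs.le (Finset.mem_range.1 hi).le) hω),
      mul_mul_mul_comm, mul_inv_cancel₀ (hc_pos n).ne', one_mul]

theorem tendsto_sum_mul_deriv (hs : IsPartitionSeq t N s) {I : Set ℝ} {f f' f'' : ℝ → ℝ}
    (hf : ∀ z ∈ I, HasDerivAt f (f' z) z) (hf' : ∀ z ∈ I, HasDerivAt f' (f'' z) z)
    (hf'' : ContinuousOn f'' I) {y α β w : ℝ≥0 → ℝ} (hy : ContinuousOn y (Set.Iic t))
    (hyI : ∀ r ≤ t, y r ∈ I) (hα : ContinuousOn α (Set.Iic t))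
    (he : Tendsto (fun n => ∑ i ∈ Finset.range (N n), f' (y (s n i)) *
      (y (s n (i + 1)) - y (s n i) - (∫ r in (s n i : ℝ)..(s n (i + 1) : ℝ), α r.toNNReal)
        - β (s n i) * (w (s n (i + 1)) - w (s n i)))) atTop (𝓝 0)) {L L'' : ℝ}
    (hL : Tendsto (fun n => ∑ i ∈ Finset.range (N n), (y (s n (i + 1)) - y (s n i)) ^ 2) atTop
      (𝓝 L))
    (hL'' : Tendsto (fun n => ∑ i ∈ Finset.range (N n),
      1 / 2 * f'' (y (s n i)) * (y (s n (i + 1)) - y (s n i)) ^ 2) atTop (𝓝 L'')) :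
    Tendsto (fun n => ∑ i ∈ Finset.range (N n),
      f' (y (s n i)) * β (s n i) * (w (s n (i + 1)) - w (s n i))) atTop
      (𝓝 (f (y t) - f (y 0) - (∫ r in (0 : ℝ)..(t : ℝ), f' (y r.toNNReal) * α r.toNNReal)
        - L'')) := by
  have htaylor := hs.tendsto_sum_taylor_two hf hf' hf'' hy hyI hL
  have hf'y : ContinuousOn (fun r => f' (y r)) (Set.Iic t) := fun r hr =>
    (hf' _ (hyI r hr)).continuousAt.comp_continuousWithinAt (hy r hr)
  have hdrift := hs.tendsto_sum_mul_integral hf'y hα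
  have hlim := (((tendsto_const_nhds (x := f (y t) - f (y 0))).sub hdrift).sub hL'').sub
    (htaylor.add he)
  rw [add_zero, sub_zero] at hlim
  refine hlim.congr fun n => ?_
  have htelescope := Finset.sum_range_sub (fun i => f (y (s n i))) (N n)
  rw [hs.finish, hs.start] at htelescope
  rw [← htelescope]
  simp only [← Finset.sum_sub_distrib, ← Finset.sum_add_distrib]
  exact Finset.sum_congr rfl fun i _ => by ring

end IsPartitionSeq

namespace HasItoDifferential

theorem tendstoInMeasure_sum_mul_sq (hX : HasItoDifferential P W τ X A B)
    (hW : IsWienerProcess P ℱ W) (hXc : IsContinuousAdapted ℱ τ X) (hA : IsContinuousAdapted ℱ τ A)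
    (hB : IsContinuousAdapted ℱ τ B) (hG : IsContinuousAdapted ℱ τ G) (hs : IsPartitionSeq t N s) :
    TendstoInMeasure (P.restrict (alive τ t)) (fun n ω => ∑ i ∈ Finset.range (N n),
      G (s n i) ω * (X (s n (i + 1)) ω - X (s n i) ω) ^ 2) atTop
      (fun ω => ∫ r in (0 : ℝ)..(t : ℝ), G r.toNNReal ω * B r.toNNReal ω ^ 2) := by
  have := hW.isProbabilityMeasure
  have hB_sq := hB.pow 2
  have hjoint := tendstoInMeasure_prodMk
    (hs.tendstoInMeasure_sum_mul_sq_increment hW (hG.mul hB_sq))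
    (tendstoInMeasure_prodMk (hs.tendstoInMeasure_sum_mul_sq_increment hW hB_sq)
      (hX.tendstoInMeasure_sum_sq_eulerError hW hA hB hs))
  refine tendstoInMeasure_of_forall_subseq hjoint
    (fun n => Finset.aestronglyMeasurable_fun_sum _ fun i hi => ?_)
    (hB.ae_restrict_alive fun ω hω ns hns hlim => ?_)
  · have hi' := Finset.mem_range.1 hi
    exact (hG.aestronglyMeasurable (hs.le hi'.le)).mul
      (((hXc.aestronglyMeasurable (hs.le hi')).sub (hXc.aestronglyMeasurable (hs.le hi'.le))).pow 2)
  · have hpath := (hs.comp hns).tendsto_sum_mul_sq_add (hG.continuousOn_Iic hω)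
      (hA.continuousOn_Iic hω) (hB.continuousOn_Iic hω) hlim.fst_nhds
      hlim.snd_nhds.fst_nhds hlim.snd_nhds.snd_nhds
    refine hpath.congr fun n => Finset.sum_congr rfl fun i _ => ?_
    simp only [eulerError, Function.comp_apply]
    ring

theorem ito_formula (hX : HasItoDifferential P W τ X A B) (hW : IsWienerProcess P ℱ W)
    (hXc : IsContinuousAdapted ℱ τ X) (hA : IsContinuousAdapted ℱ τ A)
    (hB : IsContinuousAdapted ℱ τ B) {I : Set ℝ} (hI : IsOpen I)
    (hXI : ∀ t, ∀ ω ∈ alive τ t, X t ω ∈ I) {f f' f'' : ℝ → ℝ}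
    (hf : ∀ z ∈ I, HasDerivAt f (f' z) z) (hf' : ∀ z ∈ I, HasDerivAt f' (f'' z) z)
    (hf'' : ContinuousOn f'' I) :
    HasItoDifferential P W τ (fun t ω => f (X t ω))
      (fun t ω => f' (X t ω) * A t ω + 1 / 2 * f'' (X t ω) * B t ω ^ 2)
      (fun t ω => f' (X t ω) * B t ω) := by
  have := hW.isProbabilityMeasure
  intro t N s hs
  have hone : IsContinuousAdapted ℱ τ (fun _ _ => 1) := .const hA.isStoppingTime 1
  have hhalf : IsContinuousAdapted ℱ τ (fun _ _ => 1 / 2) := .const hA.isStoppingTime _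
  have hf'X := hXc.comp hI hXI (g := f') fun z hz => (hf' z hz).continuousAt.continuousWithinAt
  have hf''X := hhalf.mul (hXc.comp hI hXI hf'')
  have hB_sq := hB.pow 2
  have herror := hX.tendstoInMeasure_sum_mul_eulerError hW hA hB hf'X hs
  have hsq := hX.tendstoInMeasure_sum_mul_sq hW hXc hA hB hone hs
  have hf''sq := hX.tendstoInMeasure_sum_mul_sq hW hXc hA hB hf''X hs
  have hjoint := tendstoInMeasure_prodMk herror (tendstoInMeasure_prodMk hsq hf''sq)
  refine tendstoInMeasure_of_forall_subseq hjoint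
    (fun n => Finset.aestronglyMeasurable_fun_sum _ fun i hi => ?_)
    (hB.ae_restrict_alive fun ω hω ns hns hlim => ?_)
  · have hW_meas : ∀ r, AEStronglyMeasurable (W r) (P.restrict (alive τ t)) := fun r =>
      ((hW.measurable r).mono (ℱ.le r) le_rfl).aestronglyMeasurable
    exact ((hf'X.mul hB).aestronglyMeasurable (hs.le (Finset.mem_range.1 hi).le)).mul
      ((hW_meas _).sub (hW_meas _))
  · have hlim_error := hlim.fst_nhds
    have hlim_sq := hlim.snd_nhds.fst_nhds
    have hlim_f''sq := hlim.snd_nhds.snd_nhds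
    simp only [one_mul] at hlim_sq
    have hpath := (hs.comp hns).tendsto_sum_mul_deriv (β := fun r => B r ω) (w := fun r => W r ω)
      hf hf' hf'' (hXc.continuousOn_Iic hω) (fun r hr => hXI r ω (alive_antitone τ hr hω))
      (hA.continuousOn_Iic hω) hlim_error hlim_sq hlim_f''sq
    have hdrift := intervalIntegrable_comp_toNNReal ((hf'X.mul hA).continuousOn_Iic hω)
      zero_le le_rfl
    have hsecond := intervalIntegrable_comp_toNNReal ((hf''X.mul hB_sq).continuousOn_Iic hω)
      zero_le le_rfl
    rw [sub_sub, ← NNReal.coe_zero, ← intervalIntegral.integral_add hdrift hsecond] at hpath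
    exact hpath

end HasItoDifferential

end ItoFormula

section Uniqueness

theorem exists_isPartitionSeq (t : ℝ≥0) : ∃ N s, IsPartitionSeq t N s := by
  have hs : Monotone fun i : ℕ => (i : ℝ≥0) * t := fun i j hij =>
    mul_le_mul_left (Nat.cast_le.2 hij) t
  have hpartition := isPartitionSeq_refinePartition hs (by rw [Nat.cast_zero, zero_mul]) 1
  rw [Nat.cast_one, one_mul] at hpartition
  exact ⟨_, _, hpartition⟩

theorem eq_zero_of_integral_eq_zero {D : Set ℝ≥0} (hD : Dense D) {t : ℝ≥0} {φ : ℝ≥0 → ℝ}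
    (hφ : ContinuousOn φ (Set.Iic t))
    (hint : ∀ q ∈ D, q < t → ∫ r in (0 : ℝ)..(q : ℝ), φ r.toNNReal = 0) {r : ℝ≥0} (hr : r < t) :
    φ r = 0 := by
  set ψ : ℝ → ℝ := fun z => φ (min z.toNNReal t)
  set F : ℝ → ℝ := fun x => ∫ z in (0 : ℝ)..x, ψ z
  have hψ : Continuous ψ :=
    hφ.comp_continuous (by fun_prop) fun z => Set.mem_Iic.2 (min_le_right z.toNNReal t)
  have hF : ∀ x, HasDerivAt F (ψ x) x := fun x => hψ.integral_hasStrictDerivAt 0 x |>.hasDerivAt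
  have hF_cont : Continuous fun q : ℝ≥0 => F q :=
    (continuous_iff_continuousAt.2 fun x => (hF x).continuousAt).comp NNReal.continuous_coe
  have hF_dense : Set.EqOn (fun q : ℝ≥0 => F q) 0 (Set.Iio t ∩ D) := fun q hq => by
    refine (intervalIntegral.integral_congr fun z hz => ?_).trans (hint q hq.2 hq.1)
    rw [Set.uIcc_of_le q.coe_nonneg] at hz
    exact congrArg φ (min_eq_left ((Real.toNNReal_le_iff_le_coe.2 hz.2).trans hq.1.le))
  have hF_zero : Set.EqOn (fun q : ℝ≥0 => F q) 0 (Set.Iio t) :=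
    hF_dense.of_subset_closure hF_cont.continuousOn continuousOn_const Set.inter_subset_left
      (hD.open_subset_closure_inter isOpen_Iio)
  have hrt : (r : ℝ) ∈ Set.Ico (0 : ℝ) t := ⟨r.coe_nonneg, hr⟩
  have hF_deriv_zero : HasDerivWithinAt F 0 (Set.Ico 0 t) r :=
    (hasDerivWithinAt_const _ _ (0 : ℝ)).congr_of_mem
      (fun x hx => hF_zero (x := ⟨x, hx.1⟩) hx.2) hrt
  have hψr : φ (min (r : ℝ).toNNReal t) = 0 :=
    (uniqueDiffOn_Ico 0 (t : ℝ) r hrt).eq_deriv _ (hF r).hasDerivWithinAt hF_deriv_zero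
  rwa [Real.toNNReal_coe, min_eq_left hr.le] at hψr

variable {Ω : Type*} {mΩ : MeasurableSpace Ω} {P : Measure Ω} {ℱ : Filtration ℝ≥0 mΩ}
  {τ : Ω → WithTop ℝ≥0} {W X X' A A' B B' : ℝ≥0 → Ω → ℝ}

theorem IsContinuousAdapted.ae_eq_zero_of_integral_eq_zero (hA : IsContinuousAdapted ℱ τ A)
    (hint : ∀ t : ℝ≥0, ∀ᵐ ω ∂P.restrict (alive τ t), ∫ r in (0 : ℝ)..(t : ℝ), A r.toNNReal ω = 0) :
    ∀ᵐ ω ∂P, ∀ t : ℝ≥0, (t : WithTop ℝ≥0) < τ ω → A t ω = 0 := by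
  obtain ⟨D, hD_countable, hD⟩ := TopologicalSpace.exists_countable_dense ℝ≥0
  have hall : ∀ᵐ ω ∂P, ∀ q ∈ D, ω ∈ alive τ q → ∫ r in (0 : ℝ)..(q : ℝ), A r.toNNReal ω = 0 :=
    (ae_ball_iff hD_countable).2 fun q _ =>
      (ae_restrict_iff' (hA.measurableSet_alive q)).1 (hint q)
  filter_upwards [hall] with ω hω t ht
  obtain ⟨c, htc, hcτ⟩ := exists_between ht
  lift c to ℝ≥0 using hcτ.ne_top
  exact eq_zero_of_integral_eq_zero hD (hA.continuousOn_Iic hcτ)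
    (fun q hq hqc => hω q hq (alive_antitone τ hqc.le hcτ)) (WithTop.coe_lt_coe.1 htc)

namespace HasItoDifferential

theorem sub (hX : HasItoDifferential P W τ X A B) (hX' : HasItoDifferential P W τ X' A' B')
    (hA : IsContinuousAdapted ℱ τ A) (hA' : IsContinuousAdapted ℱ τ A') :
    HasItoDifferential P W τ (fun t ω => X t ω - X' t ω) (fun t ω => A t ω - A' t ω)
      (fun t ω => B t ω - B' t ω) := by
  intro t N s hs
  refine (tendstoInMeasure_sub (hX t N s hs) (hX' t N s hs)).congr
    (fun n => ae_of_all _ fun ω => ?_) (hA.ae_restrict_alive fun ω hω => ?_)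
  · simp only [sub_mul, Finset.sum_sub_distrib]
  · have hintegral := intervalIntegral.integral_sub
      (intervalIntegrable_comp_toNNReal (hA.continuousOn_Iic hω) zero_le le_rfl)
      (intervalIntegrable_comp_toNNReal (hA'.continuousOn_Iic hω) zero_le le_rfl)
    rw [NNReal.coe_zero] at hintegral
    simp only [hintegral]
    ring

theorem congr (hX : HasItoDifferential P W τ X A B) (hτ : IsStoppingTime ℱ τ)
    (h : ∀ᵐ ω ∂P, ∀ t : ℝ≥0, (t : WithTop ℝ≥0) < τ ω → A t ω = A' t ω ∧ B t ω = B' t ω) :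
    HasItoDifferential P W τ X A' B' := by
  intro t N s hs
  have hIic : ∀ᵐ ω ∂P.restrict (alive τ t), ∀ r ≤ t, A r ω = A' r ω ∧ B r ω = B' r ω := by
    refine (ae_restrict_iff' (ℱ.le t _ (hτ.measurableSet_gt t))).2 ?_
    filter_upwards [h] with ω hω hωt r hr using hω r (alive_antitone τ hr hωt)
  refine (hX t N s hs).congr (fun n => ?_) ?_
  · filter_upwards [hIic] with ω hω
    exact Finset.sum_congr rfl fun i hi => by rw [(hω _ (hs.le (Finset.mem_range.1 hi).le)).2]
  · filter_upwards [hIic] with ω hω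
    congr 1
    refine intervalIntegral.integral_congr fun r hr => (hω _ ?_).1
    rw [Set.uIcc_of_le t.coe_nonneg] at hr
    exact Real.toNNReal_le_iff_le_coe.2 hr.2

theorem volatility_eq_zero (h : HasItoDifferential P W τ (fun _ _ => 0) A B)
    (hW : IsWienerProcess P ℱ W) (hA : IsContinuousAdapted ℱ τ A)
    (hB : IsContinuousAdapted ℱ τ B) :
    ∀ᵐ ω ∂P, ∀ t : ℝ≥0, (t : WithTop ℝ≥0) < τ ω → B t ω = 0 := by
  have hconst : ∀ c, IsContinuousAdapted ℱ τ (fun _ _ => c) := .const hA.isStoppingTime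
  refine ((hB.pow 2).ae_eq_zero_of_integral_eq_zero fun t => ?_).mono
    fun ω hω t ht => pow_eq_zero_iff two_ne_zero |>.1 (hω t ht)
  obtain ⟨N, s, hs⟩ := exists_isPartitionSeq t
  have hqv := h.tendstoInMeasure_sum_mul_sq hW (hconst 0) hA hB (hconst 1) hs
  simp only [sub_zero, one_mul, zero_pow two_ne_zero, Finset.sum_const_zero] at hqv
  exact tendstoInMeasure_ae_unique hqv (tendstoInMeasure_const _)

theorem drift_eq_zero (h : HasItoDifferential P W τ (fun _ _ => 0) A (fun _ _ => 0))
    (hA : IsContinuousAdapted ℱ τ A) :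
    ∀ᵐ ω ∂P, ∀ t : ℝ≥0, (t : WithTop ℝ≥0) < τ ω → A t ω = 0 := by
  refine hA.ae_eq_zero_of_integral_eq_zero fun t => ?_
  obtain ⟨N, s, hs⟩ := exists_isPartitionSeq t
  have hsum := h t N s hs
  simp only [zero_mul, sub_zero, zero_sub, Finset.sum_const_zero] at hsum
  filter_upwards [tendstoInMeasure_ae_unique hsum (tendstoInMeasure_const _)] with ω hω
  exact neg_eq_zero.1 hω

theorem unique (hX : HasItoDifferential P W τ X A B) (hX' : HasItoDifferential P W τ X A' B')
    (hW : IsWienerProcess P ℱ W) (hA : IsContinuousAdapted ℱ τ A)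
    (hA' : IsContinuousAdapted ℱ τ A') (hB : IsContinuousAdapted ℱ τ B)
    (hB' : IsContinuousAdapted ℱ τ B') :
    ∀ᵐ ω ∂P, ∀ t : ℝ≥0, (t : WithTop ℝ≥0) < τ ω → A t ω = A' t ω ∧ B t ω = B' t ω := by
  have hzero := hX.sub hX' hA hA'
  simp only [sub_self] at hzero
  have hvolatility := hzero.volatility_eq_zero hW (hA.sub hA') (hB.sub hB')
  have hdrift := (hzero.congr hA.isStoppingTime
    (hvolatility.mono fun ω hω t ht => ⟨rfl, hω t ht⟩)).drift_eq_zero (hA.sub hA')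
  filter_upwards [hvolatility, hdrift] with ω hB_eq hA_eq t ht
  exact ⟨sub_eq_zero.1 (hA_eq t ht), sub_eq_zero.1 (hB_eq t ht)⟩

end HasItoDifferential

end Uniqueness

section Transformation

variable {Ω : Type*} {mΩ : MeasurableSpace Ω} {P : Measure Ω} {ℱ : Filtration ℝ≥0 mΩ}
  {W x : ℝ≥0 → Ω → ℝ} {I : Set ℝ} {τ : Ω → WithTop ℝ≥0} {a b u : ℝ → ℝ} {aᵤ bᵤ : ℝ}

theorem IsItoSolution.isContinuousAdapted (hx : IsItoSolution P ℱ W I a b x τ) :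
    IsContinuousAdapted ℱ τ x :=
  ⟨hx.isStoppingTime, hx.adapted, hx.continuousOn⟩

theorem IsItoSolution.hasItoDifferential (hx : IsItoSolution P ℱ W I a b x τ) :
    HasItoDifferential P W τ x (fun t ω => a (x t ω)) (fun t ω => b (x t ω)) :=
  hx.sde

theorem isBrownianWithDrift_iff_hasItoDifferential (hx : IsContinuousAdapted ℱ τ x) :
    IsBrownianWithDrift P ℱ W aᵤ bᵤ x τ ↔
      HasItoDifferential P W τ x (fun _ _ => aᵤ) (fun _ _ => bᵤ) :=
  ⟨fun h => h.sde, fun h => ⟨hx.isStoppingTime, hx.adapted, hx.continuousOn,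
    fun _ _ _ => Set.mem_univ _, h⟩⟩

theorem hasDerivAt_deriv_of_contDiffOn {n : WithTop ℕ∞} (hI : IsOpen I) (hu : ContDiffOn ℝ n u I)
    (hn : n ≠ 0) {z : ℝ} (hz : z ∈ I) : HasDerivAt u (deriv u z) z :=
  ((hu.differentiableOn hn).differentiableAt (hI.mem_nhds hz)).hasDerivAt

theorem isBrownianWithDrift_comp_iff (hW : IsWienerProcess P ℱ W) (hI : IsOpen I)
    (ha : ContinuousOn a I) (hb : ContinuousOn b I) (hu : ContDiffOn ℝ 2 u I)
    (hx : IsItoSolution P ℱ W I a b x τ) :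
    IsBrownianWithDrift P ℱ W aᵤ bᵤ (fun t ω => u (x t ω)) τ ↔
      ∀ᵐ ω ∂P, ∀ t : ℝ≥0, (t : WithTop ℝ≥0) < τ ω →
        aᵤ = a (x t ω) * deriv u (x t ω) + 1 / 2 * b (x t ω) ^ 2 * deriv (deriv u) (x t ω) ∧
        bᵤ = b (x t ω) * deriv u (x t ω) := by
  have hu' : ContDiffOn ℝ 1 (deriv u) I := hu.deriv_of_isOpen hI one_add_one_eq_two.le
  have hu'' : ContinuousOn (deriv (deriv u)) I := hu'.continuousOn_deriv_of_isOpen hI le_rfl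
  have hcomp {g : ℝ → ℝ} (hg : ContinuousOn g I) : IsContinuousAdapted ℱ τ (fun t ω => g (x t ω)) :=
    hx.isContinuousAdapted.comp hI (fun t ω => hx.mem ω t) hg
  have hconst (c : ℝ) : IsContinuousAdapted ℱ τ (fun _ _ => c) := .const hx.isStoppingTime c
  have hito := (hx.hasItoDifferential.ito_formula hW hx.isContinuousAdapted (hcomp ha) (hcomp hb)
    hI (fun t ω => hx.mem ω t)
    (fun z hz => hasDerivAt_deriv_of_contDiffOn hI hu two_ne_zero hz)
    (fun z hz => hasDerivAt_deriv_of_contDiffOn hI hu' one_ne_zero hz) hu'').congr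
    (A' := fun t ω => a (x t ω) * deriv u (x t ω)
      + 1 / 2 * b (x t ω) ^ 2 * deriv (deriv u) (x t ω))
    (B' := fun t ω => b (x t ω) * deriv u (x t ω)) hx.isStoppingTime
    (ae_of_all _ fun ω t _ => ⟨by ring, by ring⟩)
  rw [isBrownianWithDrift_iff_hasItoDifferential (hcomp hu.continuousOn)]
  refine ⟨fun h => ?_, fun h => hito.congr hx.isStoppingTime
    (h.mono fun ω hω t ht => (hω t ht).imp Eq.symm Eq.symm)⟩
  exact h.unique hito hW (hconst aᵤ)
    (hcomp ((ha.mul hu'.continuousOn).add ((continuousOn_const.mul (hb.pow 2)).mul hu'')))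
    (hconst bᵤ) (hcomp (hb.mul hu'.continuousOn))

end Transformation

section ExitTime

theorem lt_hittingAfter_compl_iff {ι Ω E : Type*} [ConditionallyCompleteLinearOrder ι]
    [TopologicalSpace ι] [OrderTopology ι] [TopologicalSpace E] {J : Set E} (hJ : IsOpen J)
    {Z : ι → Ω → E} {ω : Ω} (hZ : Continuous fun r => Z r ω) {n t : ι} :
    (t : WithTop ι) < hittingAfter Z Jᶜ n ω ↔ ∀ r ∈ Set.Icc n t, Z r ω ∈ J := by
  refine ⟨fun ht r hr => not_not.1
    (notMem_of_lt_hittingAfter ((WithTop.coe_le_coe.2 hr.2).trans_lt ht) hr.1), fun h => ?_⟩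
  simp only [hittingAfter_def]
  split_ifs with hexit
  · have hclosed : IsClosed {r | n ≤ r ∧ Z r ω ∈ Jᶜ} :=
      isClosed_Ici.inter (hJ.isClosed_compl.preimage hZ)
    obtain ⟨hn, hmem⟩ := hclosed.csInf_mem hexit ⟨n, fun r hr => hr.1⟩
    exact WithTop.coe_lt_coe.2 (not_le.1 fun hle => hmem (h _ ⟨hn, hle⟩))
  · exact WithTop.coe_lt_top t

theorem measurableSet_forall_mem_of_isCompact {T Ω E : Type*} [TopologicalSpace T]
    [SecondCountableTopology T] {mΩ : MeasurableSpace Ω} [PseudoEMetricSpace E] [MeasurableSpace E]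
    [OpensMeasurableSpace E] {K : Set T} (hK : IsCompact K) {J : Set E} (hJ : IsOpen J)
    {Z : T → Ω → E} (hZ : ∀ ω, ContinuousOn (fun r => Z r ω) K) (hZm : ∀ r ∈ K, Measurable (Z r)) :
    MeasurableSet {ω | ∀ r ∈ K, Z r ω ∈ J} := by
  obtain rfl | hne := K.eq_empty_or_nonempty
  · simp
  obtain ⟨D, hD_count, hD⟩ := TopologicalSpace.exists_countable_dense K
  have := hD_count.to_subtype
  have hiff : ∀ ω, (∀ r ∈ K, Z r ω ∈ J) ↔ 0 < ⨅ r : D, Metric.infEDist (Z r ω) Jᶜ := by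
    intro ω
    let d : T → ℝ≥0∞ := fun r => Metric.infEDist (Z r ω) Jᶜ
    have hc : ContinuousOn d K :=
      Metric.continuous_infEDist.comp_continuousOn (hZ ω)
    have hinf : ⨅ r : D, d r = sInf (d '' K) :=
      (hD.ciInf' hc.domRestrict).trans (sInf_image' (f := d)).symm
    change _ ↔ 0 < ⨅ r : D, d r
    rw [hinf, hK.lt_sInf_iff_of_continuous hne hc]
    refine forall₂_congr fun r _ => ?_
    rw [pos_iff_ne_zero, ne_eq, ← Metric.mem_iff_infEDist_zero_of_closed hJ.isClosed_compl,
      Set.notMem_compl_iff]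
  simp only [hiff]
  exact measurableSet_lt measurable_const
    (.iInf fun r => measurable_infEDist.comp (hZm r r.1.2))

theorem isContinuousAdapted_hittingAfter_compl {Ω : Type*} {mΩ : MeasurableSpace Ω}
    {ℱ : Filtration ℝ≥0 mΩ} {J : Set ℝ} (hJ : IsOpen J) {Z : ℝ≥0 → Ω → ℝ}
    (hZ : ∀ ω, Continuous fun r => Z r ω) (hZm : ∀ t, Measurable[ℱ t] (Z t)) :
    IsContinuousAdapted ℱ (hittingAfter Z Jᶜ 0) Z := by
  have halive : ∀ t, MeasurableSet[ℱ t] (alive (hittingAfter Z Jᶜ 0) t) := fun t => by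
    simp only [alive, lt_hittingAfter_compl_iff hJ (hZ _)]
    exact measurableSet_forall_mem_of_isCompact isCompact_Icc hJ (fun ω => (hZ ω).continuousOn)
      fun r hr => (hZm r).mono (ℱ.mono hr.2) le_rfl
  refine ⟨fun t => ?_, fun t => ((hZm t).indicator (halive t)).stronglyMeasurable,
    fun ω => (hZ ω).continuousOn⟩
  simpa only [alive, Set.compl_ofPred, not_lt] using (halive t).compl

end ExitTime

section Existence

variable {Ω : Type*} {mΩ : MeasurableSpace Ω} {P : Measure Ω} {ℱ : Filtration ℝ≥0 mΩ}
  {W : ℝ≥0 → Ω → ℝ} {aᵤ bᵤ z₀ : ℝ}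

/-- The Brownian motion with drift `aᵤ` and volatility `bᵤ` driven by `W` that starts at `z₀`. -/
def driftedBrownian (W : ℝ≥0 → Ω → ℝ) (aᵤ bᵤ z₀ : ℝ) (t : ℝ≥0) (ω : Ω) : ℝ :=
  z₀ + aᵤ * t + bᵤ * (W t ω - W 0 ω)

theorem driftedBrownian_zero (W : ℝ≥0 → Ω → ℝ) (aᵤ bᵤ z₀ : ℝ) (ω : Ω) :
    driftedBrownian W aᵤ bᵤ z₀ 0 ω = z₀ := by
  simp [driftedBrownian]

theorem IsWienerProcess.continuous_driftedBrownian (hW : IsWienerProcess P ℱ W) (aᵤ bᵤ z₀ : ℝ)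
    (ω : Ω) : Continuous fun t => driftedBrownian W aᵤ bᵤ z₀ t ω :=
  (continuous_const.add (continuous_const.mul NNReal.continuous_coe)).add
    (continuous_const.mul ((hW.continuous ω).sub continuous_const))

theorem IsWienerProcess.measurable_driftedBrownian (hW : IsWienerProcess P ℱ W) (aᵤ bᵤ z₀ : ℝ)
    (t : ℝ≥0) : Measurable[ℱ t] (driftedBrownian W aᵤ bᵤ z₀ t) :=
  ((hW.measurable_increment (zero_le (a := t))).const_mul bᵤ).const_add _

theorem hasItoDifferential_driftedBrownian (W : ℝ≥0 → Ω → ℝ) (aᵤ bᵤ z₀ : ℝ)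
    (τ : Ω → WithTop ℝ≥0) :
    HasItoDifferential P W τ (driftedBrownian W aᵤ bᵤ z₀) (fun _ _ => aᵤ) (fun _ _ => bᵤ) := by
  intro t N s hs
  refine (tendstoInMeasure_const _).congr_left fun n => ae_of_all _ fun ω => ?_
  simp only [← Finset.mul_sum, Finset.sum_range_sub (fun i => W (s n i) ω), hs.start, hs.finish,
    intervalIntegral.integral_const, driftedBrownian, NNReal.coe_zero, smul_eq_mul]
  ring

theorem IsBrownianWithDrift.isItoSolution_comp {Z : ℝ≥0 → Ω → ℝ} {τ : Ω → WithTop ℝ≥0}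
    (hZ : IsBrownianWithDrift P ℱ W aᵤ bᵤ Z τ) (hW : IsWienerProcess P ℱ W) {I J : Set ℝ}
    (hJ : IsOpen J) (hZJ : ∀ t, ∀ ω ∈ alive τ t, Z t ω ∈ J) {a b v v' v'' : ℝ → ℝ}
    (hv : ∀ z ∈ J, HasDerivAt v (v' z) z) (hv' : ∀ z ∈ J, HasDerivAt v' (v'' z) z)
    (hv'' : ContinuousOn v'' J) (hvI : Set.MapsTo v J I)
    (ha : ∀ z ∈ J, v' z * aᵤ + 1 / 2 * v'' z * bᵤ ^ 2 = a (v z))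
    (hb : ∀ z ∈ J, v' z * bᵤ = b (v z)) :
    IsItoSolution P ℱ W I a b (fun t ω => v (Z t ω)) τ := by
  have hvZ : IsContinuousAdapted ℱ τ (fun t ω => v (Z t ω)) :=
    hZ.isContinuousAdapted.comp hJ hZJ fun z hz => (hv z hz).continuousAt.continuousWithinAt
  have hito := hZ.hasItoDifferential.ito_formula hW hZ.isContinuousAdapted
    (.const hZ.isStoppingTime aᵤ) (.const hZ.isStoppingTime bᵤ) hJ hZJ hv hv' hv''
  have hvZ_ito : HasItoDifferential P W τ (fun t ω => v (Z t ω)) (fun t ω => a (v (Z t ω)))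
      (fun t ω => b (v (Z t ω))) := hito.congr hZ.isStoppingTime (ae_of_all _ fun ω t hω =>
    ⟨ha _ (hZJ t ω hω), hb _ (hZJ t ω hω)⟩)
  exact ⟨hvZ.isStoppingTime, hvZ.adapted, hvZ.continuousOn, fun ω t hω => hvI (hZJ t ω hω), hvZ_ito⟩

theorem IsWienerProcess.exists_isBrownianWithDrift (hW : IsWienerProcess P ℱ W) {J : Set ℝ}
    (hJ : IsOpen J) (hz₀ : z₀ ∈ J) :
    ∃ (Z : ℝ≥0 → Ω → ℝ) (τ : Ω → WithTop ℝ≥0), IsBrownianWithDrift P ℱ W aᵤ bᵤ Z τ ∧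
      (∀ t, ∀ ω ∈ alive τ t, Z t ω ∈ J) ∧ ∀ ω, 0 < τ ω ∧ Z 0 ω = z₀ := by
  have hcont := hW.continuous_driftedBrownian aᵤ bᵤ z₀
  have hlt : ∀ (t : ℝ≥0) ω, (t : WithTop ℝ≥0) < hittingAfter (driftedBrownian W aᵤ bᵤ z₀) Jᶜ 0 ω ↔
      ∀ r ∈ Set.Icc 0 t, driftedBrownian W aᵤ bᵤ z₀ r ω ∈ J :=
    fun _ ω => lt_hittingAfter_compl_iff hJ (hcont ω)
  refine ⟨driftedBrownian W aᵤ bᵤ z₀, hittingAfter (driftedBrownian W aᵤ bᵤ z₀) Jᶜ 0,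
    (isBrownianWithDrift_iff_hasItoDifferential (isContinuousAdapted_hittingAfter_compl hJ hcont
      (hW.measurable_driftedBrownian aᵤ bᵤ z₀))).2
      (hasItoDifferential_driftedBrownian W aᵤ bᵤ z₀ _),
    fun t ω hω => (hlt t ω).1 hω t ⟨zero_le, le_rfl⟩,
    fun ω => ⟨(hlt 0 ω).2 fun r hr => ?_, driftedBrownian_zero ..⟩⟩
  rwa [le_antisymm hr.2 hr.1, driftedBrownian_zero]

end Existence

section Calculus

theorem contDiffOn_add_one_of_hasDerivAt {I : Set ℝ} (hI : IsOpen I) {n : WithTop ℕ∞} (hn : n ≠ ⊤)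
    {f f' : ℝ → ℝ} (hf : ∀ z ∈ I, HasDerivAt f (f' z) z) (hf' : ContDiffOn ℝ n f' I) :
    ContDiffOn ℝ (n + 1) f I :=
  (contDiffOn_succ_iff_deriv_of_isOpen hI).2
    ⟨fun z hz => (hf z hz).differentiableAt.differentiableWithinAt, fun h => (hn h).elim,
      hf'.congr fun z hz => (hf z hz).deriv⟩

theorem strictMonoOn_or_strictAntiOn_of_hasDerivAt_ne_zero {I : Set ℝ} (hI : Convex ℝ I)
    {f f' : ℝ → ℝ} (hf : ∀ z ∈ I, HasDerivAt f (f' z) z) (hf' : ∀ z ∈ I, f' z ≠ 0) :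
    StrictMonoOn f I ∨ StrictAntiOn f I := by
  have hcont : ContinuousOn f I := fun z hz => (hf z hz).continuousAt.continuousWithinAt
  obtain hneg | hpos := hasDerivWithinAt_forall_lt_or_forall_gt_of_forall_ne hI
    (fun z hz => (hf z hz).hasDerivWithinAt) hf'
  · exact .inr <| strictAntiOn_of_deriv_neg hI hcont fun z hz =>
      (hf z (interior_subset hz)).deriv ▸ hneg z (interior_subset hz)
  · exact .inl <| strictMonoOn_of_deriv_pos hI hcont fun z hz =>
      (hf z (interior_subset hz)).deriv ▸ hpos z (interior_subset hz)

theorem exists_openPartialHomeomorph_of_hasDerivAt {𝕜 : Type*} [RCLike 𝕜] {I : Set 𝕜}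
    (hI : IsOpen I) {f f' : 𝕜 → 𝕜} (hinj : Set.InjOn f I) (hf : ∀ z ∈ I, HasDerivAt f (f' z) z)
    (hf' : ContinuousOn f' I) (hne : ∀ z ∈ I, f' z ≠ 0) :
    ∃ e : OpenPartialHomeomorph 𝕜 𝕜, e.source = I ∧ ⇑e = f := by
  have hopen : IsOpenMap (I.domRestrict f) := by
    refine isOpenMap_iff_nhds_le.2 fun z => ?_
    have hstrict : HasStrictDerivAt f (f' z) z := hasStrictDerivAt_of_hasDerivAt_of_continuousAt
      (Filter.eventually_of_mem (hI.mem_nhds z.2) hf) (hf'.continuousAt (hI.mem_nhds z.2))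
    rw [Set.domRestrict_eq, ← Filter.map_map, map_nhds_subtype_coe_eq_nhds z.2 (hI.mem_nhds z.2),
      hstrict.map_nhds_eq (hne z z.2)]
    rfl
  exact ⟨.ofContinuousOpenRestrict (hinj.toPartialEquiv f I)
    (fun z hz => (hf z hz).continuousAt.continuousWithinAt) hopen hI, rfl, rfl⟩

variable {E : Type*} [NormedAddCommGroup E] [NormedSpace ℝ E] [CompleteSpace E] {I : Set ℝ}
  {f : ℝ → E}

theorem hasDerivAt_integral_of_continuousOn (hIo : IsOpen I) (hIc : I.OrdConnected)
    (hf : ContinuousOn f I) {x₀ z : ℝ} (hx₀ : x₀ ∈ I) (hz : z ∈ I) :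
    HasDerivAt (fun z => ∫ y in x₀..z, f y) (f z) z :=
  intervalIntegral.integral_hasDerivAt_right
    (hf.mono (hIc.uIcc_subset hx₀ hz)).intervalIntegrable
    (hf.stronglyMeasurableAtFilter hIo z hz) (hf.continuousAt (hIo.mem_nhds hz))

theorem exists_hasDerivAt_of_continuousOn (hIo : IsOpen I) (hIc : I.OrdConnected)
    (hf : ContinuousOn f I) : ∃ F : ℝ → E, ∀ z ∈ I, HasDerivAt F (f z) z := by
  obtain rfl | ⟨x₀, hx₀⟩ := I.eq_empty_or_nonempty
  · exact ⟨0, fun z hz => hz.elim⟩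
  · exact ⟨_, fun z hz => hasDerivAt_integral_of_continuousOn hIo hIc hf hx₀ hz⟩

end Calculus

section Consistency

/-- The consistency condition between drift `a` and volatility `b` of a dynamic on `I`. The constant
`k` stands for the quotient `aᵤ / bᵤ` of the coefficients of the Brownian motion to be reached. -/
def IsConsistent (I : Set ℝ) (a b : ℝ → ℝ) (k : ℝ) : Prop :=
  ∀ z ∈ I, a z = k * b z + 1 / 2 * b z * deriv b z

variable {I : Set ℝ} {a b u : ℝ → ℝ} {aᵤ bᵤ : ℝ}

theorem deriv_deriv_of_deriv_eq_div (hI : IsOpen I) (hb : DifferentiableOn ℝ b I)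
    (hb0 : ∀ z ∈ I, b z ≠ 0) (hu' : ∀ z ∈ I, deriv u z = bᵤ / b z) {z : ℝ} (hz : z ∈ I) :
    deriv (deriv u) z = -(bᵤ * deriv b z) / b z ^ 2 := by
  have heq : deriv u =ᶠ[𝓝 z] fun z => bᵤ / b z := eventually_of_mem (hI.mem_nhds hz) hu'
  have hdiv := (hasDerivAt_const z bᵤ).fun_div
    (hb.differentiableAt (hI.mem_nhds hz)).hasDerivAt (hb0 z hz)
  rw [heq.deriv_eq, hdiv.deriv, zero_mul, zero_sub]

theorem eq_drift_iff_eq_consistent_drift {A B B' : ℝ} (hB : B ≠ 0) (hbᵤ : bᵤ ≠ 0) :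
    aᵤ = A * (bᵤ / B) + 1 / 2 * B ^ 2 * (-(bᵤ * B') / B ^ 2) ↔
      A = aᵤ / bᵤ * B + 1 / 2 * B * B' := by
  have hdrift : A * (bᵤ / B) + 1 / 2 * B ^ 2 * (-(bᵤ * B') / B ^ 2)
      = (A - 1 / 2 * B * B') * (bᵤ / B) := by
    field_simp
    ring
  rw [hdrift, ← div_eq_iff (div_ne_zero hbᵤ hB), div_div_eq_mul_div, mul_div_right_comm,
    eq_sub_iff_add_eq, eq_comm]

theorem coefficients_eq_iff (hI : IsOpen I) (hb : DifferentiableOn ℝ b I)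
    (hb0 : ∀ z ∈ I, b z ≠ 0) (hbᵤ : bᵤ ≠ 0) :
    (∀ z ∈ I, aᵤ = a z * deriv u z + 1 / 2 * b z ^ 2 * deriv (deriv u) z ∧
        bᵤ = b z * deriv u z) ↔
      (∀ z ∈ I, deriv u z = bᵤ / b z) ∧ IsConsistent I a b (aᵤ / bᵤ) := by
  have hvol : (∀ z ∈ I, bᵤ = b z * deriv u z) ↔ ∀ z ∈ I, deriv u z = bᵤ / b z :=
    forall₂_congr fun z hz => by rw [eq_div_iff (hb0 z hz), mul_comm, eq_comm]
  rw [forall₂_and, and_comm, hvol]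
  refine and_congr_right fun hu' => forall₂_congr fun z hz => ?_
  rw [deriv_deriv_of_deriv_eq_div hI hb hb0 hu' hz, hu' z hz,
    eq_drift_iff_eq_consistent_drift (hb0 z hz) hbᵤ]

theorem contDiffOn_two_of_hasDerivAt_const_div (hI : IsOpen I) (hb : ContDiffOn ℝ 1 b I)
    (hb0 : ∀ z ∈ I, b z ≠ 0) (hu : ∀ z ∈ I, HasDerivAt u (bᵤ / b z) z) : ContDiffOn ℝ 2 u I :=
  one_add_one_eq_two (R := WithTop ℕ∞) ▸
    contDiffOn_add_one_of_hasDerivAt hI WithTop.one_ne_top hu (contDiffOn_const.div hb hb0)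

theorem hasDerivAt_const_div_iff_exists_eq_integral_add (hIo : IsOpen I) (hIc : I.OrdConnected)
    (hb : ContinuousOn b I) (hb0 : ∀ z ∈ I, b z ≠ 0) {x₀ : ℝ} (hx₀ : x₀ ∈ I) :
    (∀ z ∈ I, HasDerivAt u (bᵤ / b z) z) ↔
      ∃ C : ℝ, ∀ z ∈ I, u z = (∫ y in x₀..z, bᵤ / b y) + C := by
  have hint : ∀ z ∈ I, HasDerivAt (fun z => ∫ y in x₀..z, bᵤ / b y) (bᵤ / b z) z := fun z hz =>
    hasDerivAt_integral_of_continuousOn hIo hIc (continuousOn_const.div hb hb0) hx₀ hz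
  constructor
  · intro hu
    exact hIo.exists_eq_add_of_deriv_eq hIc.isPreconnected
      (fun z hz => (hu z hz).differentiableAt.differentiableWithinAt)
      (fun z hz => (hint z hz).differentiableAt.differentiableWithinAt)
      fun z hz => (hu z hz).deriv.trans (hint z hz).deriv.symm
  · rintro ⟨C, hC⟩ z hz
    exact ((hint z hz).add_const C).congr_of_eventuallyEq
      (eventually_of_mem (hIo.mem_nhds hz) hC)

theorem exists_strictMonoOn_hasDerivAt_const_div (hIo : IsOpen I) (hIc : I.OrdConnected)
    (hb : ContinuousOn b I) (hb0 : ∀ z ∈ I, b z ≠ 0) :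
    ∃ (c : ℝ) (u : ℝ → ℝ), c ≠ 0 ∧ StrictMonoOn u I ∧ ∀ z ∈ I, HasDerivAt u (c / b z) z := by
  obtain ⟨u, hu⟩ := exists_hasDerivAt_of_continuousOn hIo hIc
    (continuousOn_const (c := (1 : ℝ)) |>.div hb hb0)
  obtain hmono | hanti := strictMonoOn_or_strictAntiOn_of_hasDerivAt_ne_zero hIc.convex hu
    fun z hz => one_div_ne_zero (hb0 z hz)
  · exact ⟨1, u, one_ne_zero, hmono, hu⟩
  · exact ⟨-1, -u, neg_ne_zero.2 one_ne_zero, hanti.neg,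
      fun z hz => (hu z hz).neg.congr_deriv (neg_div _ _).symm⟩

end Consistency

section MapsToBrownian

variable {Ω : Type*} {mΩ : MeasurableSpace Ω} {P : Measure Ω} {ℱ : Filtration ℝ≥0 mΩ}
  {W : ℝ≥0 → Ω → ℝ} {I : Set ℝ} {a b u : ℝ → ℝ} {aᵤ bᵤ : ℝ}

theorem IsConsistent.exists_isItoSolution (hab : IsConsistent I a b (aᵤ / bᵤ))
    (hW : IsWienerProcess P ℱ W) (hIo : IsOpen I) (hIc : I.OrdConnected)
    (hb : ContDiffOn ℝ 1 b I) (hb0 : ∀ z ∈ I, b z ≠ 0) (hbᵤ : bᵤ ≠ 0) {y : ℝ} (hy : y ∈ I) :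
    ∃ (x : ℝ≥0 → Ω → ℝ) (τ : Ω → WithTop ℝ≥0), IsItoSolution P ℱ W I a b x τ ∧
      ∀ ω, 0 < τ ω ∧ x 0 ω = y := by
  have hu'_ne : ∀ z ∈ I, bᵤ / b z ≠ 0 := fun z hz => div_ne_zero hbᵤ (hb0 z hz)
  have hu'_cont : ContinuousOn (fun z => bᵤ / b z) I := continuousOn_const.div hb.continuousOn hb0
  obtain ⟨u, hu⟩ := exists_hasDerivAt_of_continuousOn hIo hIc hu'_cont
  have hinj : Set.InjOn u I :=
    (strictMonoOn_or_strictAntiOn_of_hasDerivAt_ne_zero hIc.convex hu hu'_ne).elim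
      StrictMonoOn.injOn StrictAntiOn.injOn
  obtain ⟨e, rfl, rfl⟩ :=
    exists_openPartialHomeomorph_of_hasDerivAt hIo hinj hu hu'_cont hu'_ne
  have hv : ∀ z ∈ e.target, HasDerivAt e.symm (b (e.symm z) / bᵤ) z := fun z hz => by
    simpa only [inv_div] using e.hasDerivAt_symm hz (hu'_ne _ (e.map_target hz))
      (hu _ (e.map_target hz))
  have hv' : ∀ z ∈ e.target, HasDerivAt (fun z => b (e.symm z) / bᵤ)
      (deriv b (e.symm z) * (b (e.symm z) / bᵤ) / bᵤ) z := fun z hz =>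
    ((hasDerivAt_deriv_of_contDiffOn hIo hb one_ne_zero (e.map_target hz)).comp z
      (hv z hz)).div_const bᵤ
  have hbv : ContinuousOn (fun z => b (e.symm z)) e.target :=
    hb.continuousOn.comp e.continuousOn_symm e.mapsTo_symm
  have hv'' : ContinuousOn (fun z => deriv b (e.symm z) * (b (e.symm z) / bᵤ) / bᵤ) e.target :=
    (((hb.continuousOn_deriv_of_isOpen hIo le_rfl).comp e.continuousOn_symm e.mapsTo_symm).mul
      (hbv.div_const bᵤ)).div_const bᵤ
  obtain ⟨Z, τ, hZ, hZJ, hZ0⟩ := hW.exists_isBrownianWithDrift (aᵤ := aᵤ) (bᵤ := bᵤ) e.open_target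
    (e.map_source hy)
  refine ⟨fun t ω => e.symm (Z t ω), τ, hZ.isItoSolution_comp hW e.open_target hZJ hv hv' hv''
    e.mapsTo_symm (fun z hz => ?_) (fun z _ => div_mul_cancel₀ _ hbᵤ),
    fun ω => ⟨(hZ0 ω).1, (congrArg e.symm (hZ0 ω).2).trans (e.left_inv hy)⟩⟩
  rw [hab _ (e.map_target hz)]
  field_simp

theorem mapsToBrownian_iff (hW : IsWienerProcess P ℱ W) (hIo : IsOpen I) (hIc : I.OrdConnected)
    (ha : ContinuousOn a I) (hb : ContDiffOn ℝ 1 b I) (hb0 : ∀ z ∈ I, b z ≠ 0) (hbᵤ : bᵤ ≠ 0)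
    (hu : ContDiffOn ℝ 2 u I) :
    MapsToBrownian P ℱ W I a b u aᵤ bᵤ ↔
      (∀ z ∈ I, deriv u z = bᵤ / b z) ∧ IsConsistent I a b (aᵤ / bᵤ) := by
  have := hW.isProbabilityMeasure
  rw [← coefficients_eq_iff hIo (hb.differentiableOn one_ne_zero) hb0 hbᵤ]
  refine ⟨fun ⟨hstart, hmap⟩ z hz => ?_, fun hcoeff => ⟨fun y hy => ?_, fun x τ hx => ?_⟩⟩
  · obtain ⟨x, τ, hx, hx0⟩ := hstart z hz
    have hcoeff := (isBrownianWithDrift_comp_iff hW hIo ha hb.continuousOn hu hx).1 (hmap x τ hx)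
    obtain ⟨ω, hω, hτ, rfl⟩ := (hcoeff.and hx0).exists
    exact hω 0 hτ
  · have hab : IsConsistent I a b (aᵤ / bᵤ) :=
      ((coefficients_eq_iff hIo (hb.differentiableOn one_ne_zero) hb0 hbᵤ).1 hcoeff).2
    obtain ⟨x, τ, hx, hx0⟩ := hab.exists_isItoSolution hW hIo hIc hb hb0 hbᵤ hy
    exact ⟨x, τ, hx, ae_of_all _ hx0⟩
  · exact (isBrownianWithDrift_comp_iff hW hIo ha hb.continuousOn hu hx).2
      (ae_of_all _ fun ω t ht => hcoeff _ (hx.mem ω t ht))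

theorem contDiffOn_and_mapsToBrownian_iff (hW : IsWienerProcess P ℱ W) (hIo : IsOpen I)
    (hIc : I.OrdConnected) (ha : ContinuousOn a I) (hb : ContDiffOn ℝ 1 b I)
    (hb0 : ∀ z ∈ I, b z ≠ 0) (hbᵤ : bᵤ ≠ 0) :
    ContDiffOn ℝ 2 u I ∧ MapsToBrownian P ℱ W I a b u aᵤ bᵤ ↔
      (∀ z ∈ I, HasDerivAt u (bᵤ / b z) z) ∧ IsConsistent I a b (aᵤ / bᵤ) := by
  constructor
  · rintro ⟨hu, hmap⟩
    obtain ⟨hu', hab⟩ := (mapsToBrownian_iff hW hIo hIc ha hb hb0 hbᵤ hu).1 hmap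
    exact ⟨fun z hz => hu' z hz ▸ hasDerivAt_deriv_of_contDiffOn hIo hu two_ne_zero hz, hab⟩
  · rintro ⟨hu', hab⟩
    have hu := contDiffOn_two_of_hasDerivAt_const_div hIo hb hb0 hu'
    exact ⟨hu, (mapsToBrownian_iff hW hIo hIc ha hb hb0 hbᵤ hu).2
      ⟨fun z hz => (hu' z hz).deriv, hab⟩⟩

theorem exists_strictMonoOn_or_strictAntiOn_mapsToBrownian_iff (hW : IsWienerProcess P ℱ W)
    (hIo : IsOpen I) (hIc : I.OrdConnected) (ha : ContinuousOn a I) (hb : ContDiffOn ℝ 1 b I)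
    (hb0 : ∀ z ∈ I, b z ≠ 0) (hbᵤ : bᵤ ≠ 0) :
    (∃ u : ℝ → ℝ, ContDiffOn ℝ 2 u I ∧ (StrictMonoOn u I ∨ StrictAntiOn u I) ∧
        MapsToBrownian P ℱ W I a b u aᵤ bᵤ) ↔ IsConsistent I a b (aᵤ / bᵤ) := by
  have hiff (u : ℝ → ℝ) := contDiffOn_and_mapsToBrownian_iff (u := u) (aᵤ := aᵤ) hW hIo hIc ha hb
    hb0 hbᵤ
  refine ⟨fun ⟨u, hu, _, hmap⟩ => ((hiff u).1 ⟨hu, hmap⟩).2, fun hab => ?_⟩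
  obtain ⟨u, hu'⟩ := exists_hasDerivAt_of_continuousOn hIo hIc
    (continuousOn_const.div hb.continuousOn hb0)
  obtain ⟨hu, hmap⟩ := (hiff u).2 ⟨hu', hab⟩
  exact ⟨u, hu, strictMonoOn_or_strictAntiOn_of_hasDerivAt_ne_zero hIc.convex hu'
    fun z hz => div_ne_zero hbᵤ (hb0 z hz), hmap⟩

theorem exists_strictMonoOn_mapsToBrownian_iff (hW : IsWienerProcess P ℱ W) (hIo : IsOpen I)
    (hIc : I.OrdConnected) (ha : ContinuousOn a I) (hb : ContDiffOn ℝ 1 b I)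
    (hb0 : ∀ z ∈ I, b z ≠ 0) :
    (∃ (aᵤ bᵤ : ℝ) (u : ℝ → ℝ), bᵤ ≠ 0 ∧ ContDiffOn ℝ 2 u I ∧ StrictMonoOn u I ∧
        MapsToBrownian P ℱ W I a b u aᵤ bᵤ) ↔ ∃ k : ℝ, IsConsistent I a b k := by
  constructor
  · rintro ⟨aᵤ, bᵤ, u, hbᵤ, hu, -, hmap⟩
    exact ⟨aᵤ / bᵤ, ((mapsToBrownian_iff hW hIo hIc ha hb hb0 hbᵤ hu).1 hmap).2⟩
  · rintro ⟨k, hab⟩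
    obtain ⟨c, u, hc, hmono, hu'⟩ :=
      exists_strictMonoOn_hasDerivAt_const_div hIo hIc hb.continuousOn hb0
    have hab_c : IsConsistent I a b (k * c / c) := (mul_div_cancel_right₀ k hc).symm ▸ hab
    obtain ⟨hu, hmap⟩ :=
      (contDiffOn_and_mapsToBrownian_iff hW hIo hIc ha hb hb0 hc).2 ⟨hu', hab_c⟩
    exact ⟨k * c, c, u, hc, hu, hmono, hmap⟩

end MapsToBrownian

theorem mainTheorem2 {Ω : Type*} {mΩ : MeasurableSpace Ω} (P : Measure Ω)
    (ℱ : Filtration ℝ≥0 mΩ) (W : ℝ≥0 → Ω → ℝ) (hW : IsWienerProcess P ℱ W)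
    (I : Set ℝ) (hIo : IsOpen I) (hIc : I.OrdConnected)
    (a b : ℝ → ℝ) (ha : ContinuousOn a I) (hb : ContDiffOn ℝ 1 b I) (hb0 : ∀ x ∈ I, b x ≠ 0) :
    -- along a single wealth process: the two equations for the coefficients
    (∀ (aᵤ bᵤ : ℝ) (u : ℝ → ℝ), ContDiffOn ℝ 2 u I →
      ∀ (x : ℝ≥0 → Ω → ℝ) (τ : Ω → WithTop ℝ≥0), IsItoSolution P ℱ W I a b x τ →
        (IsBrownianWithDrift P ℱ W aᵤ bᵤ (fun t ω => u (x t ω)) τ ↔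
          ∀ᵐ ω ∂P, ∀ t : ℝ≥0, (t : WithTop ℝ≥0) < τ ω →
            aᵤ = a (x t ω) * deriv u (x t ω) + 1 / 2 * b (x t ω) ^ 2 * deriv (deriv u) (x t ω) ∧
            bᵤ = b (x t ω) * deriv u (x t ω))) ∧
    -- for the dynamic on the whole of `I`, with given constants
    (∀ aᵤ bᵤ : ℝ, bᵤ ≠ 0 →
      (∀ u : ℝ → ℝ, ContDiffOn ℝ 2 u I →
        (MapsToBrownian P ℱ W I a b u aᵤ bᵤ ↔
          ∀ x ∈ I, deriv u x = bᵤ / b x ∧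
            a x = aᵤ / bᵤ * b x + 1 / 2 * b x * deriv b x)) ∧
      ((∃ u : ℝ → ℝ, ContDiffOn ℝ 2 u I ∧ (StrictMonoOn u I ∨ StrictAntiOn u I) ∧
          MapsToBrownian P ℱ W I a b u aᵤ bᵤ) ↔
        ∀ x ∈ I, a x = aᵤ / bᵤ * b x + 1 / 2 * b x * deriv b x) ∧
      ((∀ x ∈ I, a x = aᵤ / bᵤ * b x + 1 / 2 * b x * deriv b x) →
        ∀ x₀ ∈ I, ∀ u : ℝ → ℝ,
          (ContDiffOn ℝ 2 u I ∧ MapsToBrownian P ℱ W I a b u aᵤ bᵤ) ↔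
            ∃ C : ℝ, ∀ x ∈ I, u x = (∫ y in x₀..x, bᵤ / b y) + C)) ∧
    -- existence of an increasing utility is decided by the dynamic alone
    ((∃ (aᵤ bᵤ : ℝ) (u : ℝ → ℝ), bᵤ ≠ 0 ∧ ContDiffOn ℝ 2 u I ∧ StrictMonoOn u I ∧
        MapsToBrownian P ℱ W I a b u aᵤ bᵤ) ↔
      ∃ k : ℝ, ∀ x ∈ I, a x = k * b x + 1 / 2 * b x * deriv b x) := by
  refine ⟨fun aᵤ bᵤ u hu x τ hx => isBrownianWithDrift_comp_iff hW hIo ha hb.continuousOn hu hx,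
    fun aᵤ bᵤ hbᵤ => ⟨fun u hu => ?_, ?_, fun hab x₀ hx₀ u => ?_⟩, ?_⟩
  · exact (mapsToBrownian_iff hW hIo hIc ha hb hb0 hbᵤ hu).trans forall₂_and.symm
  · exact exists_strictMonoOn_or_strictAntiOn_mapsToBrownian_iff hW hIo hIc ha hb hb0 hbᵤ
  · rw [contDiffOn_and_mapsToBrownian_iff hW hIo hIc ha hb hb0 hbᵤ,
      hasDerivAt_const_div_iff_exists_eq_integral_add hIo hIc hb.continuousOn hb0 hx₀]
    exact and_iff_left hab
  · exact exists_strictMonoOn_mapsToBrownian_iff hW hIo hIc ha hb hb0
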